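/- Let $\Omega\subseteq\mathbb R^n$ be open, $X=\mathbb R^m$, and let $Z$ be a Hausdorff real topological vector space in which every bounded subset $E$ is relatively complete (its closure is complete) and perfect (every family in $Z$ all of whose finite partial sums lie in $E$ is unconditionally summable). Let $\mathcal G$ be the family of open subsets of $\Omega$, $\mathcal B$ the family of nonempty closed, balanced, totally bounded subsets of $X$, and let $(\mathcal F,\mathcal K)$ be one of the following pairs: (i) $\mathcal F=\mathcal C_p(\Omega,\mathbb R^m)$, the continuous functions $\Omega\to\mathbb R^m$ with totally bounded range, and $\mathcal K$ the closed subsets of $\Omega$; (ii) $\mathcal F=\mathcal C_c^\infty(\Omega,\mathbb R^m)$, the infinitely differentiable functions with compact support in $\Omega$, and $\mathcal K$ the compact subsets of $\Omega$. Let $\ell:\mathcal F\to Z$ be linear and continuous for the topology of uniform convergence on $\Omega$. Then $\ell$ has the integral representation $$\ell(f)=\int_\Omega f\,d\nu_\ell\qquad\text{for all } f\in\mathcal F,$$ where $\nu_\ell$, the set function generated by $\ell$, exists and is a Riesz measure over $(\mathcal K,\mathcal G,\mathcal B)$. Here the terms have the following meaning. *Generation of $\nu_\ell$.* For $f:\Omega\to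 X$ write $f\prec\alpha$ if $f$ vanishes off some $\kappa\in\mathcal K$ with $\kappa\subseteq\alpha$, and say that $f$ equals $x$ over $\alpha$ if $f=x$ on some $\gamma\in\mathcal G$ with $\gamma\supseteq\alpha$. For $\kappa\in\mathcal K$ and $x\in X$, $\tau_\ell(\kappa)(x)$ is the limit of the filter base of the sets $\{\ell(f): f\in\mathcal F,\ f(\Omega)\subseteq B,\ f \text{ equals } x \text{ over } \kappa,\ f\prec\beta\}$, $\beta\in\mathcal G$, $\beta\supseteq\kappa$ (for every $B\in\mathcal B$ containing $x$, with a limit independent of $B$). Then $\xi_\ell(\gamma)=\lim_{\kappa\in\mathcal K,\kappa\subseteq\gamma}\tau_\ell(\kappa)$ for $\gamma\in\mathcal G$ and $\nu_\ell(\alpha)=\lim_{\gamma\in\mathcal G,\gamma\supseteq\alpha}\xi_\ell(\gamma)$ for every $\alpha\subseteq\Omega$, pointwise on $X$; that these limits exist is part of the assertion. *Riesz measures.* Let $h$ assign to each subset of $\Omega$ a map $X\to Z$; write $x.h(\alpha)=h(\alpha)(x)$. For an entourage $W$ of $Z$ and $B\in\mathcal B$, a set $\alpha$ is $W$-small for $(h,B)$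 if there is $\gamma\in\mathcal G$, $\gamma\supseteq\alpha$, with $\big(\sum_{\kappa\in L}x_\kappa.h(\kappa),\sum_{\kappa\in L}(x_\kappa+y_\kappa).h(\kappa)\big)\in W$ for all finite disjoint $L\subseteq\mathcal K$ with $\bigcup L\subseteq\gamma$ and all $x,y:L\to B$. $\mathcal R_h$ is the family of sets $\alpha$ such that for all $B\in\mathcal B$ and entourages $V$ there are $\kappa\in\mathcal K$, $\gamma\in\mathcal G$ with $\kappa\subseteq\alpha\subseteq\gamma$ and $\gamma\setminus\kappa$ $V$-small for $(h,B)$. $h$ is a Riesz measure if: (1) $\mathcal G\subseteq\mathcal R_h$; (2) $\mathcal R_h$ is a field of sets on which $h$ is additive, with $h(\emptyset)=0$; (3) $h(\gamma)=\lim_{\kappa\in\mathcal K,\kappa\subseteq\gamma}h(\kappa)$ and $h(\alpha)=\lim_{\gamma\in\mathcal G,\gamma\supseteq\alpha}h(\gamma)$ pointwise on $X$, for all $\gamma\in\mathcal G$, $\alpha\subseteq\Omega$; (4) for every entourage $W$ of $Z$ and $B\in\mathcal B$ there is an entourage $U$ of $X$ such that $\big(\sum_{\rho\in R}x_\rho.h(\rho),\sum_{\rho\in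 R}y_\rho.h(\rho)\big)\in W$ for all finite disjoint $R\subseteq\mathcal R_h$ and $x,y:R\to B$ with $(x_\rho,y_\rho)\in U$ for all $\rho\in R$; (5) for every $B\in\mathcal B$, entourage $V$ and disjoint sequence $(\alpha_k)$ in $\mathcal R_h$, $\alpha_k$ is $V$-small for $(h,B)$ for all large $k$; (6) for every $B\in\mathcal B$, the set of all sums $\sum_{\rho\in R}x_\rho.h(\rho)$, with $R\subseteq\mathcal R_h$ finite and disjoint and $x:R\to B$, is relatively complete. *Integral.* $\int_\Omega f\,dh=z$ means that for each neighbourhood $V$ of $z$ there is a finite partition $Q$ of $\Omega$ into members of $\mathcal R_h$ such that $\sum_{\rho\in R}f(s_\rho).h(\rho)\in V$ for every finite partition $R$ of $\Omega$ into members of $\mathcal R_h$ finer than $Q$ and every choice of points $s_\rho\in\rho$. -/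

import Mathlib

open Set Filter Topology

/-! ### Summability and completeness conditions on the range space -/

/-- A subset `E` is perfect if every family all of whose finite partial sums lie in `E` is
(unconditionally) summable. The index sets are taken in the lowest universe, which contains
`ℕ`. -/
def PerfectForSums {Z : Type*} [AddCommMonoid Z] [TopologicalSpace Z] (E : Set Z) : Prop :=
  ∀ (ι : Type) (f : ι → Z), (∀ J : Finset ι, ∑ j ∈ J, f j ∈ E) → Summable f

/-- A subset is relatively complete if its closure is complete. -/
def RelativelyComplete {Z : Type*} [UniformSpace Z] (E : Set Z) : Prop :=
  IsComplete (closure E)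

/-! ### The families of sets and of functions -/

/-- The closed, balanced, totally bounded (nonempty) subsets of `X`. -/
def closedBalancedTotallyBounded (X : Type*) [AddCommGroup X] [Module ℝ X] [UniformSpace X] :
    Set (Set X) :=
  {B | B.Nonempty ∧ IsClosed B ∧ Balanced ℝ B ∧ TotallyBounded B}

/-- `C_p(S, X)`: the continuous functions from `S` to `X` with totally bounded range. -/
def Cp (S X : Type*) [TopologicalSpace S] [AddCommGroup X] [Module ℝ X] [UniformSpace X]
    [IsUniformAddGroup X] [ContinuousSMul ℝ X] : Submodule ℝ (S → X) where
  carrier := {f | Continuous f ∧ TotallyBounded (range f)}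
  zero_mem' := by
    refine ⟨continuous_const, (Set.Finite.subset (Set.finite_singleton (0 : X)) ?_).totallyBounded⟩
    rintro _ ⟨s, rfl⟩
    simp
  add_mem' := by
    rintro f g ⟨hf, hf'⟩ ⟨hg, hg'⟩
    refine ⟨hf.add hg, ?_⟩
    have h : TotallyBounded (range f ×ˢ range g) := by
      rw [totallyBounded_iff_ultrafilter]
      intro u hu
      have h1 := totallyBounded_iff_ultrafilter.1 hf' (u.map Prod.fst)
        (le_principal_iff.2 (mem_of_superset (x := range f ×ˢ range g) (le_principal_iff.1 hu)
          fun p hp => hp.1))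
      have h2 := totallyBounded_iff_ultrafilter.1 hg' (u.map Prod.snd)
        (le_principal_iff.2 (mem_of_superset (x := range f ×ˢ range g) (le_principal_iff.1 hu)
          fun p hp => hp.2))
      exact (h1.prod h2).mono le_prod_map_fst_snd
    refine (h.image (uniformContinuous_add (α := X))).subset ?_
    rintro _ ⟨s, rfl⟩
    exact ⟨(f s, g s), ⟨⟨s, rfl⟩, ⟨s, rfl⟩⟩, rfl⟩
  smul_mem' := by
    rintro c f ⟨hf, hf'⟩
    refine ⟨hf.const_smul c, (hf'.image (f := fun x : X => c • x) ?_).subset ?_⟩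
    · exact uniformContinuous_addMonoidHom_of_continuous
        (f := DistribSMul.toAddMonoidHom X c) (continuous_const_smul c)
    rintro _ ⟨s, rfl⟩
    exact ⟨f s, ⟨s, rfl⟩, rfl⟩

/-- `C_c^∞(Ω, X)`: the infinitely differentiable functions with compact support contained in
the open set `Ω`, regarded as functions on `Ω`. -/
def CcSmooth {E : Type*} [NormedAddCommGroup E] [NormedSpace ℝ E]
    (Ω : TopologicalSpace.Opens E) (X : Type*) [NormedAddCommGroup X] [NormedSpace ℝ X] :
    Submodule ℝ (Ω → X) where
  carrier := {f | ∃ g : TestFunction Ω X ⊤, ∀ s : Ω, f s = g s}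
  zero_mem' := ⟨0, fun _ => rfl⟩
  add_mem' := by
    rintro f g ⟨f', hf⟩ ⟨g', hg⟩
    exact ⟨f' + g', fun s => by simp [hf s, hg s]⟩
  smul_mem' := by
    rintro c f ⟨f', hf⟩
    exact ⟨c • f', fun s => by simp [hf s]⟩

section RieszMeasures

variable {S X Z : Type*} [AddCommGroup X] [Module ℝ X] [UniformSpace X]
  [AddCommGroup Z] [Module ℝ Z] [UniformSpace Z]

/-- Continuity of `ℓ` for the topology of uniform convergence on `S`. -/
def ContinuousForUniformConvergence (F : Submodule ℝ (S → X)) (ℓ : F →ₗ[ℝ] Z) : Prop :=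
  Continuous[TopologicalSpace.induced (fun f : F => UniformFun.ofFun (f : S → X)) inferInstance,
    inferInstance] ℓ

/-! ### Small and regular sets, Riesz measures

A `Z^X`-valued set function is a function `h : Set S → X → Z`, and `x.h(α)` is `h α x`.
The fixed data are families `K` and `G` of subsets of `S` and a family `𝓑` of subsets of `X`. -/

/-- `α` is `W`-small with respect to `(h, B)`; only the restriction of `h` to `K` is used. -/
def IsSmall (K G : Set (Set S)) (h : Set S → X → Z) (B : Set X) (W : Set (Z × Z))
    (α : Set S) : Prop :=
  ∃ γ ∈ G, α ⊆ γ ∧ ∀ L : Finset (Set S), (L : Set (Set S)) ⊆ K →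
    (L : Set (Set S)).PairwiseDisjoint id → (∀ κ ∈ L, κ ⊆ γ) →
    ∀ x y : Set S → X, (∀ κ ∈ L, x κ ∈ B) → (∀ κ ∈ L, y κ ∈ B) →
      (∑ κ ∈ L, h κ (x κ), ∑ κ ∈ L, h κ (x κ + y κ)) ∈ W

/-- The family `R_h` of all sets that are regular with respect to `(h, K, G, 𝓑)`. -/
def regularSets (K G : Set (Set S)) (𝓑 : Set (Set X)) (h : Set S → X → Z) : Set (Set S) :=
  {α | ∀ B ∈ 𝓑, ∀ V ∈ uniformity Z, ∃ κ ∈ K, ∃ γ ∈ G,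
    κ ⊆ α ∧ α ⊆ γ ∧ IsSmall K G h B V (γ \ κ)}

/-- `Z^X`-valued Riesz measures over `(K, G, 𝓑)`. -/
structure IsRieszMeasure (K G : Set (Set S)) (𝓑 : Set (Set X)) (h : Set S → X → Z) : Prop where
  subset_regularSets : G ⊆ regularSets K G 𝓑 h
  isSetAlgebra : MeasureTheory.IsSetAlgebra (regularSets K G 𝓑 h)
  map_empty : h ∅ = 0
  additive : ∀ α ∈ regularSets K G 𝓑 h, ∀ β ∈ regularSets K G 𝓑 h,
    h (α ∪ β) + h (α ∩ β) = h α + h β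
  inner_limit : ∀ γ ∈ G, ∀ x : X,
    Tendsto (fun κ : {κ : Set S // κ ∈ K ∧ κ ⊆ γ} => h κ x) atTop (𝓝 (h γ x))
  outer_limit : ∀ α : Set S, ∀ x : X,
    Tendsto (fun γ : {γ : Set S // γ ∈ G ∧ α ⊆ γ} => h γ x) atBot (𝓝 (h α x))
  /-- uniform partition continuity -/
  partition_continuous : ∀ W ∈ uniformity Z, ∀ B ∈ 𝓑, ∃ U ∈ uniformity X,
    ∀ R : Finset (Set S), (R : Set (Set S)) ⊆ regularSets K G 𝓑 h →
      (R : Set (Set S)).PairwiseDisjoint id →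
      ∀ x y : Set S → X, (∀ ρ ∈ R, x ρ ∈ B) → (∀ ρ ∈ R, y ρ ∈ B) →
        (∀ ρ ∈ R, (x ρ, y ρ) ∈ U) → (∑ ρ ∈ R, h ρ (x ρ), ∑ ρ ∈ R, h ρ (y ρ)) ∈ W
  s_bounded : ∀ B ∈ 𝓑, ∀ α : ℕ → Set S, (∀ n, α n ∈ regularSets K G 𝓑 h) →
    Pairwise (fun i j => Disjoint (α i) (α j)) →
    ∀ V ∈ uniformity Z, ∃ m : ℕ, ∀ n > m, IsSmall K G h B V (α n)
  relativelyComplete_sums : ∀ B ∈ 𝓑, RelativelyComplete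
    {z : Z | ∃ (R : Finset (Set S)) (x : Set S → X),
      (R : Set (Set S)) ⊆ regularSets K G 𝓑 h ∧ (R : Set (Set S)).PairwiseDisjoint id ∧
      (∀ ρ ∈ R, x ρ ∈ B) ∧ z = ∑ ρ ∈ R, h ρ (x ρ)}

/-! ### The integral -/

/-- `R` is a finite partition of `E` into regular sets. -/
def IsRegularPartition (K G : Set (Set S)) (𝓑 : Set (Set X)) (h : Set S → X → Z) (E : Set S)
    (R : Finset (Set S)) : Prop :=
  (R : Set (Set S)) ⊆ regularSets K G 𝓑 h ∧ (R : Set (Set S)).PairwiseDisjoint id ∧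
    ⋃₀ (R : Set (Set S)) = E

/-- `f` is integrable over `E` with respect to `h`, with integral `z`: the sums
`∑ f(s_ρ).h(ρ)` over finite regular partitions of `E` and choice functions `s` converge
to `z` under refinement. -/
def HasRieszIntegral (K G : Set (Set S)) (𝓑 : Set (Set X)) (h : Set S → X → Z) (E : Set S)
    (f : S → X) (z : Z) : Prop :=
  ∀ V ∈ 𝓝 z, ∃ Q : Finset (Set S), IsRegularPartition K G 𝓑 h E Q ∧
    ∀ R : Finset (Set S), IsRegularPartition K G 𝓑 h E R → (∀ ρ ∈ R, ∃ q ∈ Q, ρ ⊆ q) →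
      ∀ s : R → S, (∀ ρ : R, s ρ ∈ (ρ : Set S)) → ∑ ρ : R, h ρ (f (s ρ)) ∈ V

/-! ### The Riesz measure of a linear map -/

/-- `f ≺ α`: the function `f` is supported by `α`. -/
def SupportedBy (K : Set (Set S)) (f : S → X) (α : Set S) : Prop :=
  ∃ κ ∈ K, κ ⊆ α ∧ ∀ s ∉ κ, f s = 0

/-- `f` equals `x` over `α`, that is, on some member of `G` containing `α`. -/
def EqualsOver (G : Set (Set S)) (f : S → X) (x : X) (α : Set S) : Prop :=
  ∃ γ ∈ G, α ⊆ γ ∧ ∀ s ∈ γ, f s = x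

/-- The intersection of all members of `𝓑` that contain `x`. -/
def hull (𝓑 : Set (Set X)) (x : X) : Set X := ⋂₀ {B ∈ 𝓑 | x ∈ B}

/-- The filter on `F` with base the sets of all `f ∈ F` with range in `B` that equal `x` over `κ`
and are supported by `β`, where `β` runs through the members of `G` containing `κ`. -/
def approxFilter (K G : Set (Set S)) (F : Submodule ℝ (S → X)) (x : X) (κ : Set S) (B : Set X) :
    Filter F :=
  ⨅ β ∈ {β ∈ G | κ ⊆ β}, 𝓟 {f : F | range (f : S → X) ⊆ B ∧ EqualsOver G (f : S → X) x κ ∧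
    SupportedBy K (f : S → X) β}

/-- The set function `τ_ℓ` (meaningful on `K`). -/
noncomputable def tauOf (K G : Set (Set S)) (𝓑 : Set (Set X)) (F : Submodule ℝ (S → X))
    (ℓ : F →ₗ[ℝ] Z) (κ : Set S) (x : X) : Z :=
  limUnder (approxFilter K G F x κ (hull 𝓑 x)) ℓ

/-- The set function `ξ_ℓ` (meaningful on `G`): the limit of `τ_ℓ(κ)` over `κ ∈ K`, `κ ⊆ γ`. -/
noncomputable def xiOf (K G : Set (Set S)) (𝓑 : Set (Set X)) (F : Submodule ℝ (S → X))
    (ℓ : F →ₗ[ℝ] Z) (γ : Set S) (x : X) : Z :=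
  limUnder atTop (fun κ : {κ : Set S // κ ∈ K ∧ κ ⊆ γ} => tauOf K G 𝓑 F ℓ κ x)

/-- The set function `ν_ℓ`: the limit of `ξ_ℓ(γ)` over `γ ∈ G`, `γ ⊇ α`. -/
noncomputable def nuOf (K G : Set (Set S)) (𝓑 : Set (Set X)) (F : Submodule ℝ (S → X))
    (ℓ : F →ₗ[ℝ] Z) (α : Set S) (x : X) : Z :=
  limUnder atBot (fun γ : {γ : Set S // γ ∈ G ∧ α ⊆ γ} => xiOf K G 𝓑 F ℓ γ x)

/-- The limits that define `ν_ℓ` exist, `ν_ℓ` is a Riesz measure, and every `f ∈ F` is integrable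
over `S` with respect to `ν_ℓ` with `∫ f dν_ℓ = ℓ(f)`. -/
structure RepresentedByRieszMeasure (K G : Set (Set S)) (𝓑 : Set (Set X))
    (F : Submodule ℝ (S → X)) (ℓ : F →ₗ[ℝ] Z) : Prop where
  approxFilter_neBot : ∀ κ ∈ K, ∀ x : X, ∀ B ∈ 𝓑, x ∈ B → (approxFilter K G F x κ B).NeBot
  tendsto_tau : ∀ κ ∈ K, ∀ x : X, ∀ B ∈ 𝓑, x ∈ B →
    Tendsto ℓ (approxFilter K G F x κ B) (𝓝 (tauOf K G 𝓑 F ℓ κ x))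
  tendsto_xi : ∀ γ ∈ G, ∀ x : X,
    Tendsto (fun κ : {κ : Set S // κ ∈ K ∧ κ ⊆ γ} => tauOf K G 𝓑 F ℓ κ x) atTop
      (𝓝 (xiOf K G 𝓑 F ℓ γ x))
  tendsto_nu : ∀ α : Set S, ∀ x : X,
    Tendsto (fun γ : {γ : Set S // γ ∈ G ∧ α ⊆ γ} => xiOf K G 𝓑 F ℓ γ x) atBot
      (𝓝 (nuOf K G 𝓑 F ℓ α x))
  isRieszMeasure : IsRieszMeasure K G 𝓑 (nuOf K G 𝓑 F ℓ)
  hasIntegral : ∀ f : F,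
    HasRieszIntegral K G 𝓑 (nuOf K G 𝓑 F ℓ) univ (f : S → X) (ℓ f)

end RieszMeasures

/-! Perfectness of the bounded subsets of `Z` forces `ℓ(f_k) → 0` for every uniformly bounded
sequence of functions with disjoint supports: their partial sums stay bounded, so the series
`∑ ℓ(f_k)` converges unconditionally. Hence `ℓ` is small on functions that are bounded by a constant
and supported by `γ \ κ`, for suitable `κ ∈ K` inside a given open set `γ`, since otherwise such
functions with disjoint supports could be chosen one after the other. The same argument gives the
Cauchy property behind `τ_ℓ`, `ξ_ℓ` and `ν_ℓ`, and relative completeness turns it into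
convergence.

Given disjoint regular sets `ρ_i`, choose `κ_i ∈ K` exhausting them up to small sets, and cutoff
functions `φ_i` of the `κ_i` with disjoint supports. The sums `∑ ν_ℓ(ρ_i)(x_i)` are approximated by
`ℓ(∑ φ_i x_i)`, the value of `ℓ` at a single function with the same bound as the family `(x_i)`. All
properties of Riesz measures and the convergence of Riemann sums to `ℓ(f)` follow from this. -/

/-! ### Continuous group seminorms -/

open scoped Uniformity SetRel in
theorem exists_uniformContinuous_pseudoMetricSpace.{u} {α : Type u} [UniformSpace α]
    {V : Set (α × α)} (hV : V ∈ 𝓤 α) :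
    ∃ (β : Type u) (_ : PseudoMetricSpace β) (i : α → β), UniformContinuous i ∧
      ∃ δ > 0, ∀ x y, dist (i x) (i y) < δ → (x, y) ∈ V := by
  have exists_half (U : {U // U ∈ 𝓤 α}) : ∃ W : {W // W ∈ 𝓤 α},
      (∀ q ∈ W.1, q.swap ∈ W.1) ∧ W.1 ○ W.1 ⊆ U.1 := by
    obtain ⟨W, hW, hsymm, hcomp⟩ := comp_symm_mem_uniformity_sets U.2
    exact ⟨⟨W, hW⟩, fun q hq => hsymm.symm _ _ hq, hcomp⟩
  choose half half_symm half_comp using exists_half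
  let W (n : ℕ) : {W // W ∈ 𝓤 α} := half^[n + 1] ⟨V, hV⟩
  have W_succ (n : ℕ) : W (n + 1) = half (W n) := Function.iterate_succ_apply' half (n + 1) _
  have W_refl (n : ℕ) (x : α) : (x, x) ∈ (W n).1 := refl_mem_uniformity (W n).2
  have W_symm (n : ℕ) : ∀ q ∈ (W n).1, q.swap ∈ (W n).1 := by
    simp only [W, Function.iterate_succ_apply']
    exact half_symm _
  have W_mem (n : ℕ) : (W n).1 ∈ ⨅ n, 𝓟 (W n).1 := mem_iInf_of_mem n (mem_principal_self _)
  have hle : 𝓤 α ≤ ⨅ n, 𝓟 (W n).1 := le_iInf fun n => le_principal_iff.2 (W n).2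
  have hWV : (W 0).1 ⊆ V := fun q hq => half_comp ⟨V, hV⟩ ⟨q.1, W_refl 0 _, hq⟩
  -- the coarser uniformity generated by the `W n` is countably generated, hence metrizable
  let u : UniformSpace α := .ofCore
    { uniformity := ⨅ n, 𝓟 (W n).1
      refl := refl_le_uniformity.trans hle
      symm := tendsto_iInf.2 fun n =>
        tendsto_principal.2 (mem_of_superset (W_mem n) (W_symm n))
      comp := le_iInf fun n => le_principal_iff.2 <|
        mem_of_superset (mem_lift' (W_mem (n + 1))) <| by
          rw [W_succ]
          exact half_comp (W n) }
  have : IsCountablyGenerated 𝓤[u] := inferInstanceAs (⨅ n, 𝓟 (W n).1).IsCountablyGenerated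
  obtain ⟨d, hd⟩ := @UniformSpace.metrizable_uniformity α u this
  obtain ⟨δ, hδ, hδW⟩ := Metric.mem_uniformity_dist.1
    (hd ▸ (W_mem 0 : (W 0).1 ∈ 𝓤[u]) : (W 0).1 ∈ 𝓤[d.toUniformSpace])
  refine ⟨α, d, id, ?_, δ, hδ, fun x y hxy => hWV (hδW hxy)⟩
  exact hd ▸ hle

section TranslationSeminorm

variable {Z M : Type*} [AddCommGroup Z] [PseudoMetricSpace M]

theorem bddAbove_range_min_dist_translate (i : Z → M) (z : Z) :
    BddAbove (range fun x => min (dist (i (x + z)) (i x)) 1) :=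
  ⟨1, forall_mem_range.2 fun _ => min_le_right _ _⟩

/-- The group seminorm `z ↦ sup_x min (d(i(x + z), i(x))) 1` of a map `i` from an additive group
to a pseudometric space: truncation keeps the supremum finite, and the supremum over all translates
turns the triangle inequality into subadditivity. -/
noncomputable def translationSeminorm (i : Z → M) : AddGroupSeminorm Z where
  toFun z := ⨆ x, min (dist (i (x + z)) (i x)) 1
  map_zero' := by simp
  add_le' a b := by
    refine ciSup_le fun x => ?_
    have ha := le_ciSup (bddAbove_range_min_dist_translate i a) x
    have hb := le_ciSup (bddAbove_range_min_dist_translate i b) (x + a)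
    have htri := dist_triangle (i (x + (a + b))) (i (x + a)) (i x)
    rw [← add_assoc] at htri ⊢
    grind [dist_nonneg (x := i (x + a)) (y := i x),
      dist_nonneg (x := i (x + a + b)) (y := i (x + a))]
  neg' z := by
    refine (Equiv.subRight z).iSup_congr fun x => ?_
    simp [dist_comm, sub_eq_add_neg]

theorem min_dist_le_translationSeminorm (i : Z → M) (z : Z) :
    min (dist (i z) (i 0)) 1 ≤ translationSeminorm i z := by
  have h := le_ciSup (bddAbove_range_min_dist_translate i z) 0
  rwa [zero_add] at h

theorem translationSeminorm_le {i : Z → M} {z : Z} {ε : ℝ}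
    (h : ∀ x, dist (i (x + z)) (i x) ≤ ε) : translationSeminorm i z ≤ ε :=
  ciSup_le fun x => (min_le_left _ _).trans (h x)

end TranslationSeminorm

section GroupSeminorms

variable {Z : Type*} [AddCommGroup Z]

theorem map_sum_sub_sum_le {ι : Type*} (p : AddGroupSeminorm Z) (t : Finset ι) (a b : ι → Z) :
    p (∑ i ∈ t, a i - ∑ i ∈ t, b i) ≤ ∑ i ∈ t, p (a i - b i) := by
  rw [← Finset.sum_sub_distrib]
  exact Finset.le_sum_of_subadditive p (map_zero p).le (map_add_le_add p) t _

theorem map_sub_le_of_sub_le {p : AddGroupSeminorm Z} {a b z : Z} {ε ε' : ℝ}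
    (ha : p (a - z) ≤ ε) (hb : p (b - z) ≤ ε') : p (a - b) ≤ ε + ε' := by
  rw [map_sub_rev] at hb
  exact (le_map_sub_add_map_sub p a z b).trans (add_le_add ha hb)

variable [UniformSpace Z] [IsUniformAddGroup Z]

theorem addGroupSeminorm_mem_uniformity {p : AddGroupSeminorm Z} (hp : Continuous p) {ε : ℝ}
    (hε : 0 < ε) : {q : Z × Z | p (q.2 - q.1) < ε} ∈ uniformity Z := by
  rw [uniformity_eq_comap_nhds_zero]
  exact preimage_mem_comap (hp.continuousAt.preimage_mem_nhds (Iio_mem_nhds (by rwa [map_zero])))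

theorem continuous_translationSeminorm {M : Type*} [PseudoMetricSpace M] {i : Z → M}
    (hi : UniformContinuous i) : Continuous (translationSeminorm i) := by
  refine continuous_iff_continuousAt.2 fun z => Metric.tendsto_nhds.2 fun ε hε => ?_
  have hmem := hi (Metric.dist_mem_uniformity (half_pos hε))
  rw [uniformity_eq_comap_nhds_zero] at hmem
  obtain ⟨N, hN, hNε⟩ := hmem
  have htendsto : Tendsto (z - ·) (𝓝 z) (𝓝 0) := by
    simpa using (continuous_sub_left z).tendsto z
  filter_upwards [htendsto hN] with w hw
  have hdist (x : Z) : dist (i (x + (w - z))) (i x) < ε / 2 :=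
    @hNε (x + (w - z), x) (by simpa using hw)
  calc |translationSeminorm i w - translationSeminorm i z|
      ≤ translationSeminorm i (w - z) := abs_sub_map_le_sub _ w z
    _ ≤ ε / 2 := translationSeminorm_le fun x => (hdist x).le
    _ < ε := half_lt_self hε

theorem exists_addGroupSeminorm_of_mem_uniformity {V : Set (Z × Z)} (hV : V ∈ uniformity Z) :
    ∃ p : AddGroupSeminorm Z, Continuous p ∧ ∀ a b, p (b - a) < 1 → (a, b) ∈ V := by
  rw [uniformity_eq_comap_nhds_zero] at hV
  obtain ⟨N, hN, hNV⟩ := hV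
  obtain ⟨M, _, i, hi, δ, hδ, hδN⟩ := exists_uniformContinuous_pseudoMetricSpace
    (uniformity_eq_comap_nhds_zero Z ▸ preimage_mem_comap hN)
  obtain ⟨n, hn⟩ := exists_nat_gt (1 / min δ 1)
  rw [div_lt_iff₀ (lt_min hδ one_pos)] at hn
  refine ⟨n • translationSeminorm i, (continuous_translationSeminorm hi).const_smul n,
    fun a b hab => hNV ?_⟩
  have hp : n * translationSeminorm i (b - a) < n * min δ 1 := by
    rw [← nsmul_eq_mul]
    exact hab.trans hn
  have hlt := (min_dist_le_translationSeminorm i (b - a)).trans_lt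
    (lt_of_mul_lt_mul_left hp n.cast_nonneg)
  have hdist : dist (i 0) (i (b - a)) < δ := by grind [dist_comm]
  simpa using hδN _ _ hdist

theorem mem_closure_of_addGroupSeminorm {A : Set Z} {z : Z}
    (h : ∀ p : AddGroupSeminorm Z, Continuous p → ∀ ε > 0, ∃ a ∈ A, p (a - z) ≤ ε) :
    z ∈ closure A := by
  refine UniformSpace.mem_closure_iff_ball.2 fun {V} hV => ?_
  obtain ⟨p, hp, hpV⟩ := exists_addGroupSeminorm_of_mem_uniformity hV
  obtain ⟨a, ha, hpa⟩ := h p hp (1 / 2) one_half_pos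
  exact ⟨a, hpV z a (hpa.trans_lt one_half_lt_one), ha⟩

theorem eq_of_addGroupSeminorm [T1Space Z] {a b : Z}
    (h : ∀ p : AddGroupSeminorm Z, Continuous p → ∀ ε > 0, p (b - a) ≤ ε) : a = b := by
  have : a ∈ closure {b} := mem_closure_of_addGroupSeminorm fun p hp ε hε => ⟨b, rfl, h p hp ε hε⟩
  rwa [closure_singleton] at this

theorem exists_tendsto_of_addGroupSeminorm {ι : Type*} {l : Filter ι} [l.NeBot] {u : ι → Z}
    {C : Set Z} (hC : IsComplete C) (hu : ∀ᶠ i in l, u i ∈ C)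
    (h : ∀ p : AddGroupSeminorm Z, Continuous p → ∀ ε > 0, ∃ z, ∀ᶠ i in l, p (z - u i) ≤ ε) :
    ∃ z ∈ C, Tendsto u l (𝓝 z) := by
  refine hC (l.map u) ⟨inferInstance, fun W hW => ?_⟩ (le_principal_iff.2 hu)
  obtain ⟨p, hp, hpW⟩ := exists_addGroupSeminorm_of_mem_uniformity hW
  obtain ⟨z, hz⟩ := h p hp (1 / 3) (by norm_num)
  rw [prod_map_map_eq, mem_map]
  filter_upwards [hz.prod_mk hz] with q hq
  refine hpW _ _ ?_
  calc p (u q.2 - u q.1) ≤ p (u q.2 - z) + p (z - u q.1) := le_map_sub_add_map_sub p _ _ _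
    _ ≤ 1 / 3 + 1 / 3 := by gcongr; exacts [map_sub_rev p _ _ ▸ hq.2, hq.1]
    _ < 1 := by norm_num

end GroupSeminorms
/-! ### Cutoff systems -/

section CutoffSystems

variable {S X Y : Type*} [AddCommGroup Y]

theorem SupportedBy.mono {K : Set (Set S)} {f : S → Y} {α β : Set S} (hf : SupportedBy K f α)
    (h : α ⊆ β) : SupportedBy K f β := by
  obtain ⟨κ, hκ, hκα, h0⟩ := hf
  exact ⟨κ, hκ, hκα.trans h, h0⟩

theorem SupportedBy.support_subset {K : Set (Set S)} {f : S → Y} {α : Set S}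
    (hf : SupportedBy K f α) : Function.support f ⊆ α := by
  obtain ⟨κ, -, hκα, h0⟩ := hf
  exact (Function.support_subset_iff'.2 h0).trans hκα

variable [NormedAddCommGroup X] [NormedSpace ℝ X]

/-- The functions in `F` that are bounded by `r` in the supremum norm. -/
def supBall (F : Submodule ℝ (S → X)) (r : ℝ) : Set F :=
  {f | ∀ s, ‖(f : S → X) s‖ ≤ r}

variable [TopologicalSpace S]

/-- `φ` is a cutoff function for `κ` in `β`: it has values in `[0, 1]`, equals `1` over `κ`, is
supported by `β`, and multiplication by `φ` maps constant functions and `F` into `F`. -/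
structure IsCutoff (K : Set (Set S)) (F : Submodule ℝ (S → X)) (κ β : Set S) (φ : S → ℝ) :
    Prop where
  mem_Icc : ∀ s, φ s ∈ Icc (0 : ℝ) 1
  eq_one : EqualsOver {γ : Set S | IsOpen γ} φ 1 κ
  supportedBy : SupportedBy K φ β
  const_mem : ∀ x : X, (fun s => φ s • x) ∈ F
  smul_mem : ∀ f ∈ F, (fun s => φ s • f s) ∈ F

/-- The common features of the two concrete pairs `(F, K)`: `K` is a lattice of closed sets, and
`F` is a space of bounded continuous functions with enough cutoff functions for `K`. -/
structure IsCutoffSystem (K : Set (Set S)) (F : Submodule ℝ (S → X)) : Prop where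
  isClosed : ∀ κ ∈ K, IsClosed κ
  empty_mem : ∅ ∈ K
  union_mem : ∀ κ ∈ K, ∀ κ' ∈ K, κ ∪ κ' ∈ K
  inter_mem : ∀ κ ∈ K, ∀ c, IsClosed c → κ ∩ c ∈ K
  continuous : ∀ f ∈ F, Continuous f
  bounded : ∀ f ∈ F, ∃ C : ℝ, ∀ s, ‖f s‖ ≤ C
  supportedBy_univ : ∀ f ∈ F, SupportedBy K f univ
  exists_cutoff : ∀ κ ∈ K, ∀ β, IsOpen β → κ ⊆ β → ∃ φ : S → ℝ, IsCutoff K F κ β φ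

variable {K : Set (Set S)} {F : Submodule ℝ (S → X)} {κ α β : Set S} {φ : S → ℝ} {r : ℝ}

namespace IsCutoff

/-- The linear map `x ↦ φ x` from the constants into `F`. -/
def const (hφ : IsCutoff K F κ β φ) : X →ₗ[ℝ] F where
  toFun x := ⟨fun s => φ s • x, hφ.const_mem x⟩
  map_add' _ _ := Subtype.ext (funext fun s => smul_add (φ s) _ _)
  map_smul' c _ := Subtype.ext (funext fun s => smul_comm (φ s) c _)

/-- Multiplication by `φ` as a linear map on `F`. -/
def mul (hφ : IsCutoff K F κ β φ) : F →ₗ[ℝ] F where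
  toFun f := ⟨fun s => φ s • (f : S → X) s, hφ.smul_mem f f.2⟩
  map_add' _ _ := Subtype.ext (funext fun s => smul_add (φ s) _ _)
  map_smul' c _ := Subtype.ext (funext fun s => smul_comm (φ s) c _)

theorem coe_sub_mul (hφ : IsCutoff K F κ β φ) (f : F) (s : S) :
    ((f - hφ.mul f : F) : S → X) s = (1 - φ s) • (f : S → X) s := by
  rw [sub_smul, one_smul]
  rfl

theorem norm_smul_le (hφ : IsCutoff K F κ β φ) (s : S) (x : X) : ‖φ s • x‖ ≤ ‖x‖ := by
  rw [norm_smul, Real.norm_of_nonneg (hφ.mem_Icc s).1]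
  exact mul_le_of_le_one_left (norm_nonneg _) (hφ.mem_Icc s).2

theorem const_mem_supBall (hφ : IsCutoff K F κ β φ) {x : X} (hx : ‖x‖ ≤ r) :
    hφ.const x ∈ supBall F r :=
  fun s => (hφ.norm_smul_le s x).trans hx

theorem mul_mem_supBall (hφ : IsCutoff K F κ β φ) {f : F} (hf : f ∈ supBall F r) :
    hφ.mul f ∈ supBall F r :=
  fun s => (hφ.norm_smul_le s _).trans (hf s)

theorem sub_mul_mem_supBall (hφ : IsCutoff K F κ β φ) {f : F} (hf : f ∈ supBall F r) :
    f - hφ.mul f ∈ supBall F r := fun s => by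
  obtain ⟨h0, h1⟩ := hφ.mem_Icc s
  rw [hφ.coe_sub_mul, norm_smul, Real.norm_of_nonneg (sub_nonneg.2 h1)]
  exact (mul_le_of_le_one_left (norm_nonneg _) (by linarith)).trans (hf s)

theorem smul_supportedBy (hφ : IsCutoff K F κ β φ) (f : S → X) :
    SupportedBy K (fun s => φ s • f s) β := by
  obtain ⟨σ, hσ, hσβ, h0⟩ := hφ.supportedBy
  exact ⟨σ, hσ, hσβ, fun s hs => by simp only [h0 s hs, zero_smul]⟩

end IsCutoff

namespace IsCutoffSystem

theorem sdiff_mem (hF : IsCutoffSystem K F) {γ : Set S} (hκ : κ ∈ K) (hγ : IsOpen γ) :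
    κ \ γ ∈ K :=
  hF.inter_mem κ hκ γᶜ hγ.isClosed_compl

theorem supportedBy_add (hF : IsCutoffSystem K F) {f g : S → Y} (hf : SupportedBy K f α)
    (hg : SupportedBy K g α) : SupportedBy K (f + g) α := by
  obtain ⟨κ, hκ, hκα, h0⟩ := hf
  obtain ⟨κ', hκ', hκα', h0'⟩ := hg
  refine ⟨κ ∪ κ', hF.union_mem κ hκ κ' hκ', union_subset hκα hκα', fun s hs => ?_⟩
  rw [mem_union, not_or] at hs
  rw [Pi.add_apply, h0 s hs.1, h0' s hs.2, add_zero]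

theorem supportedBy_sub (hF : IsCutoffSystem K F) {f g : S → Y} (hf : SupportedBy K f α)
    (hg : SupportedBy K g α) : SupportedBy K (f - g) α := by
  obtain ⟨κ, hκ, hκα, h0⟩ := hg
  rw [sub_eq_add_neg]
  exact hF.supportedBy_add hf ⟨κ, hκ, hκα, fun s hs => by rw [Pi.neg_apply, h0 s hs, neg_zero]⟩

theorem supportedBy_sum (hF : IsCutoffSystem K F) {ι : Type*} (t : Finset ι) {f : ι → S → Y}
    (hf : ∀ i ∈ t, SupportedBy K (f i) α) : SupportedBy K (∑ i ∈ t, f i) α :=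
  Finset.sum_induction f (SupportedBy K · α) (fun _ _ => hF.supportedBy_add)
    ⟨∅, hF.empty_mem, empty_subset _, fun _ _ => rfl⟩ hf

theorem supportedBy_of_eq_zero (hF : IsCutoffSystem K F) {f : S → Y} {w : Set S}
    (hf : SupportedBy K f α) (hw : IsOpen w) (h0 : ∀ s ∈ w, f s = 0) (h : α \ w ⊆ β) :
    SupportedBy K f β := by
  obtain ⟨κ, hκ, hκα, hκ0⟩ := hf
  refine ⟨κ \ w, hF.sdiff_mem hκ hw, (sdiff_subset_sdiff_left hκα).trans h, fun s hs => ?_⟩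
  by_cases hsw : s ∈ w
  · exact h0 s hsw
  · exact hκ0 s fun hsκ => hs ⟨hsκ, hsw⟩

theorem supportedBy_sub_mul (hF : IsCutoffSystem K F) (hφ : IsCutoff K F κ β φ) {f : F}
    (hf : SupportedBy K (f : S → X) α) :
    SupportedBy K ((f - hφ.mul f : F) : S → X) (α \ κ) := by
  obtain ⟨σ, hσ, hσα, h0⟩ := hf
  obtain ⟨w, hw, hκw, hw1⟩ := hφ.eq_one
  refine hF.supportedBy_of_eq_zero (α := α) ⟨σ, hσ, hσα, fun s hs => ?_⟩ hw (fun s hs => ?_)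
    (sdiff_subset_sdiff_right hκw)
  · rw [hφ.coe_sub_mul, h0 s hs, smul_zero]
  · rw [hφ.coe_sub_mul, hw1 s hs, sub_self, zero_smul]

theorem exists_open_between (hF : IsCutoffSystem K F) (hκ : κ ∈ K) (hβ : IsOpen β)
    (hκβ : κ ⊆ β) : ∃ w, IsOpen w ∧ ∃ σ ∈ K, κ ⊆ w ∧ w ⊆ σ ∧ σ ⊆ β := by
  obtain ⟨φ, hφ⟩ := hF.exists_cutoff κ hκ β hβ hκβ
  obtain ⟨w, hw, hκw, hw1⟩ := hφ.eq_one
  obtain ⟨σ, hσ, hσβ, hσ0⟩ := hφ.supportedBy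
  refine ⟨w, hw, σ, hσ, hκw, fun s hs => ?_, hσβ⟩
  by_contra hsσ
  exact one_ne_zero ((hw1 s hs).symm.trans (hσ0 s hsσ))

end IsCutoffSystem

end CutoffSystems

/-! ### Exhaustive linear maps -/

section Exhaustive

open scoped Function

variable {S X Z : Type*} [NormedAddCommGroup X] [NormedSpace ℝ X] [AddCommGroup Z] [Module ℝ Z]
  [UniformSpace Z] {F : Submodule ℝ (S → X)} {ℓ : F →ₗ[ℝ] Z} {p : AddGroupSeminorm Z} {r ε : ℝ}

/-- `ℓ` is continuous for uniform convergence, tends to zero along uniformly bounded sequences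
with pairwise disjoint supports, and maps bounded sets to relatively complete sets. -/
structure IsExhaustive (ℓ : F →ₗ[ℝ] Z) : Prop where
  eventually_mem : ∀ V ∈ 𝓝 (0 : Z), ∃ δ > 0, ∀ f ∈ supBall F δ, ℓ f ∈ V
  tendsto_zero : ∀ (r : ℝ) (f : ℕ → F), (∀ k, f k ∈ supBall F r) →
    Pairwise (Disjoint on fun k => Function.support (f k : S → X)) →
    Tendsto (fun k => ℓ (f k)) atTop (𝓝 0)
  relativelyComplete : ∀ r, RelativelyComplete (ℓ '' supBall F r)

namespace IsExhaustive

theorem exists_le (hℓ : IsExhaustive ℓ) (hp : Continuous p) (hε : 0 < ε) :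
    ∃ δ > 0, ∀ f ∈ supBall F δ, p (ℓ f) ≤ ε := by
  have hV : {z | p z < ε} ∈ 𝓝 (0 : Z) :=
    (isOpen_lt hp continuous_const).mem_nhds (by simpa only [mem_ofPred_eq, map_zero] using hε)
  obtain ⟨δ, hδ, h⟩ := hℓ.eventually_mem _ hV
  exact ⟨δ, hδ, fun f hf => (h f hf).le⟩

theorem exists_apply_le (hℓ : IsExhaustive ℓ) (hp : Continuous p) (hε : 0 < ε) {f : ℕ → F}
    (hf : ∀ k, f k ∈ supBall F r)
    (hd : Pairwise (Disjoint on fun k => Function.support (f k : S → X))) :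
    ∃ k, p (ℓ (f k)) ≤ ε := by
  have h0 : Tendsto (fun k => p (ℓ (f k))) atTop (𝓝 0) := by
    simpa only [map_zero, Function.comp_def] using
      (hp.tendsto 0).comp (hℓ.tendsto_zero r f hf hd)
  exact (h0.eventually_le_const hε).exists

end IsExhaustive

end Exhaustive

/-! ### Small and regular sets of a linear map -/

section SmallSets

variable {S X Z : Type*} [TopologicalSpace S] [NormedAddCommGroup X] [NormedSpace ℝ X]
  [AddCommGroup Z] [Module ℝ Z] {K : Set (Set S)} {F : Submodule ℝ (S → X)}

/-- `α` has an open neighbourhood `γ` such that `p (ℓ f) ≤ ε` for all functions `f ∈ F` bounded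
by `r` and supported by `γ`. This is the counterpart of `IsSmall` for `ℓ` in place of its
set function. -/
def SmallOn (K : Set (Set S)) (ℓ : F →ₗ[ℝ] Z) (p : AddGroupSeminorm Z) (r ε : ℝ)
    (α : Set S) : Prop :=
  ∃ γ, IsOpen γ ∧ α ⊆ γ ∧ ∀ f ∈ supBall F r, SupportedBy K (f : S → X) γ → p (ℓ f) ≤ ε

variable {ℓ : F →ₗ[ℝ] Z} {p : AddGroupSeminorm Z} {r ε : ℝ} {α β : Set S}

namespace SmallOn

theorem mono {r' ε' : ℝ} (h : SmallOn K ℓ p r ε β) (hαβ : α ⊆ β) (hr : r' ≤ r) (hε : ε ≤ ε') :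
    SmallOn K ℓ p r' ε' α := by
  obtain ⟨γ, hγ, hβγ, hle⟩ := h
  exact ⟨γ, hγ, hαβ.trans hβγ, fun f hf hfγ => (hle f (fun s => (hf s).trans hr) hfγ).trans hε⟩

theorem le (h : SmallOn K ℓ p r ε α) {f : F} (hf : f ∈ supBall F r)
    (hfα : SupportedBy K (f : S → X) α) : p (ℓ f) ≤ ε := by
  obtain ⟨γ, -, hαγ, hle⟩ := h
  exact hle f hf (hfα.mono hαγ)

theorem empty : SmallOn K ℓ p r 0 ∅ := by
  refine ⟨∅, isOpen_empty, Subset.rfl, fun f _ hf => ?_⟩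
  have hf0 : f = 0 := Subtype.ext (Function.support_eq_empty_iff.1
    (subset_empty_iff.1 hf.support_subset))
  rw [hf0, map_zero, map_zero]

end SmallOn

theorem exists_lt_of_not_smallOn (hα : IsOpen α) (h : ¬SmallOn K ℓ p r ε α) :
    ∃ f ∈ supBall F r, SupportedBy K (f : S → X) α ∧ ε < p (ℓ f) := by
  by_contra! hle
  exact h ⟨α, hα, Subset.rfl, hle⟩

namespace IsCutoffSystem

theorem smallOn_union (hF : IsCutoffSystem K F) {ε' : ℝ} (hα : SmallOn K ℓ p r ε α)
    (hβ : SmallOn K ℓ p r ε' β) : SmallOn K ℓ p r (ε + ε') (α ∪ β) := by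
  obtain ⟨γ, hγ, hαγ, hγε⟩ := hα
  obtain ⟨δ, hδ, hβδ, hδε⟩ := hβ
  refine ⟨γ ∪ δ, hγ.union hδ, union_subset_union hαγ hβδ, fun f hf hfs => ?_⟩
  obtain ⟨κ, hκ, hκs, h0⟩ := hfs
  obtain ⟨φ, hφ⟩ := hF.exists_cutoff (κ \ δ) (hF.sdiff_mem hκ hδ) γ hγ
    (fun s hs => (hκs hs.1).resolve_right hs.2)
  have hγ_part : p (ℓ (hφ.mul f)) ≤ ε := hγε _ (hφ.mul_mem_supBall hf) (hφ.smul_supportedBy f)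
  have hδ_part : p (ℓ (f - hφ.mul f)) ≤ ε' :=
    hδε _ (hφ.sub_mul_mem_supBall hf) <|
      (hF.supportedBy_sub_mul hφ ⟨κ, hκ, Subset.rfl, h0⟩).mono <| by
        rw [sdiff_sdiff_right_self]
        exact inter_subset_right
  calc p (ℓ f) = p (ℓ (hφ.mul f) + ℓ (f - hφ.mul f)) := by rw [← map_add, add_sub_cancel]
    _ ≤ ε + ε' := (map_add_le_add p _ _).trans (add_le_add hγ_part hδ_part)

theorem smallOn_biUnion (hF : IsCutoffSystem K F) {ι : Type*} (t : Finset ι) {α : ι → Set S}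
    {ε : ι → ℝ} (h : ∀ i ∈ t, SmallOn K ℓ p r (ε i) (α i)) :
    SmallOn K ℓ p r (∑ i ∈ t, ε i) (⋃ i ∈ t, α i) := by
  classical
  induction t using Finset.induction_on with
  | empty => simpa using SmallOn.empty
  | insert i t hi ih =>
    rw [Finset.sum_insert hi, Finset.set_biUnion_insert]
    exact hF.smallOn_union (h i (Finset.mem_insert_self _ _))
      (ih fun j hj => h j (Finset.mem_insert_of_mem hj))

end IsCutoffSystem

open scoped Function

variable [UniformSpace Z]

namespace IsCutoffSystem

-- Otherwise there are functions `f k` with `ε < p (ℓ (f k))`, each supported by `γ` minus the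
-- carriers of its predecessors.
theorem exists_inner (hF : IsCutoffSystem K F) (hℓ : IsExhaustive ℓ) (hp : Continuous p) (r : ℝ)
    (hε : 0 < ε) {γ : Set S} (hγ : IsOpen γ) : ∃ κ ∈ K, κ ⊆ γ ∧ SmallOn K ℓ p r ε (γ \ κ) := by
  by_contra! H
  have step : ∀ κ : {κ : Set S // κ ∈ K ∧ κ ⊆ γ}, ∃ f : F, ∃ κ' : {κ : Set S // κ ∈ K ∧ κ ⊆ γ},
      f ∈ supBall F r ∧ Function.support (f : S → X) ⊆ κ'.1 \ κ.1 ∧ κ.1 ⊆ κ'.1 ∧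
      ε < p (ℓ f) := by
    rintro ⟨κ, hκ, hκγ⟩
    obtain ⟨f, hf, ⟨σ, hσ, hσγ, h0⟩, hpf⟩ :=
      exists_lt_of_not_smallOn (hγ.sdiff (hF.isClosed κ hκ)) (H κ hκ hκγ)
    have hsupp : Function.support (f : S → X) ⊆ σ := Function.support_subset_iff'.2 h0
    exact ⟨f, ⟨κ ∪ σ, hF.union_mem κ hκ σ hσ, union_subset hκγ (hσγ.trans sdiff_subset)⟩, hf,
      fun s hs => ⟨Or.inr (hsupp hs), (hσγ (hsupp hs)).2⟩, subset_union_left, hpf⟩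
  choose f next hf hsupp hsub hpf using step
  let κ : ℕ → {κ : Set S // κ ∈ K ∧ κ ⊆ γ} := fun n => next^[n] ⟨∅, hF.empty_mem, empty_subset _⟩
  have κ_succ (n) : κ (n + 1) = next (κ n) := Function.iterate_succ_apply' _ _ _
  have κ_mono : Monotone fun n => (κ n).1 :=
    monotone_nat_of_le_succ fun n => (hsub (κ n)).trans_eq (congrArg Subtype.val (κ_succ n).symm)
  have hd : Pairwise (Disjoint on fun n => Function.support (f (κ n) : S → X)) := by
    refine (pairwise_disjoint_on _).2 fun i j hij => ?_
    refine (disjoint_sdiff_right.mono_left ?_).mono_right (hsupp (κ j))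
    calc Function.support (f (κ i) : S → X) ⊆ (next (κ i)).1 := (hsupp (κ i)).trans sdiff_subset
      _ = (κ (i + 1)).1 := by rw [κ_succ]
      _ ⊆ (κ j).1 := κ_mono hij
  obtain ⟨k, hk⟩ := hℓ.exists_apply_le hp hε (fun n => hf (κ n)) hd
  exact hk.not_gt (hpf _)

theorem exists_outer (hF : IsCutoffSystem K F) (hℓ : IsExhaustive ℓ) (hp : Continuous p) (r : ℝ)
    (hε : 0 < ε) {κ : Set S} (hκ : κ ∈ K) :
    ∃ β, IsOpen β ∧ κ ⊆ β ∧ SmallOn K ℓ p r ε (β \ κ) := by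
  obtain ⟨σ, hσ, hσκ, h⟩ := hF.exists_inner hℓ hp r hε (hF.isClosed κ hκ).isOpen_compl
  refine ⟨σᶜ, (hF.isClosed σ hσ).isOpen_compl, subset_compl_comm.1 hσκ, h.mono ?_ le_rfl le_rfl⟩
  exact fun s hs => ⟨hs.2, hs.1⟩

end IsCutoffSystem

/-- `α` can be approximated from inside by members of `K` and from outside by open sets. This is
the counterpart of `regularSets` for `ℓ` in place of its set function. -/
def IsRegularFor (K : Set (Set S)) (ℓ : F →ₗ[ℝ] Z) (α : Set S) : Prop :=
  ∀ p : AddGroupSeminorm Z, Continuous p → ∀ r : ℝ, ∀ ε > 0, ∃ κ ∈ K, ∃ γ, IsOpen γ ∧ κ ⊆ α ∧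
    α ⊆ γ ∧ SmallOn K ℓ p r ε (γ \ κ)

namespace IsCutoffSystem

theorem isRegularFor_of_isOpen (hF : IsCutoffSystem K F) (hℓ : IsExhaustive ℓ) {γ : Set S}
    (hγ : IsOpen γ) : IsRegularFor K ℓ γ := by
  intro p hp r ε hε
  obtain ⟨κ, hκ, hκγ, h⟩ := hF.exists_inner hℓ hp r hε hγ
  exact ⟨κ, hκ, γ, hγ, hκγ, Subset.rfl, h⟩

theorem isRegularFor_of_mem (hF : IsCutoffSystem K F) (hℓ : IsExhaustive ℓ) {κ : Set S}
    (hκ : κ ∈ K) : IsRegularFor K ℓ κ := by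
  intro p hp r ε hε
  obtain ⟨β, hβ, hκβ, h⟩ := hF.exists_outer hℓ hp r hε hκ
  exact ⟨κ, hκ, β, hβ, Subset.rfl, hκβ, h⟩

theorem isRegularFor_compl (hF : IsCutoffSystem K F) (hℓ : IsExhaustive ℓ)
    (hα : IsRegularFor K ℓ α) : IsRegularFor K ℓ αᶜ := by
  intro p hp r ε hε
  obtain ⟨κ, hκ, γ, hγ, hκα, hαγ, h⟩ := hα p hp r (ε / 2) (half_pos hε)
  obtain ⟨σ, hσ, -, h'⟩ := hF.exists_inner hℓ hp r (half_pos hε) isOpen_univ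
  refine ⟨σ \ γ, hF.sdiff_mem hσ hγ, κᶜ, (hF.isClosed κ hκ).isOpen_compl,
    fun s hs h => hs.2 (hαγ h), compl_subset_compl.2 hκα,
    (hF.smallOn_union h h').mono (fun s hs => ?_) le_rfl (add_halves ε).le⟩
  by_cases hsγ : s ∈ γ
  · exact Or.inl ⟨hsγ, hs.1⟩
  · exact Or.inr ⟨mem_univ s, fun hsσ => hs.2 ⟨hsσ, hsγ⟩⟩

theorem isRegularFor_union (hF : IsCutoffSystem K F) (hα : IsRegularFor K ℓ α)
    (hβ : IsRegularFor K ℓ β) : IsRegularFor K ℓ (α ∪ β) := by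
  intro p hp r ε hε
  obtain ⟨κ, hκ, γ, hγ, hκα, hαγ, h⟩ := hα p hp r (ε / 2) (half_pos hε)
  obtain ⟨κ', hκ', γ', hγ', hκβ, hβγ, h'⟩ := hβ p hp r (ε / 2) (half_pos hε)
  refine ⟨κ ∪ κ', hF.union_mem κ hκ κ' hκ', γ ∪ γ', hγ.union hγ', union_subset_union hκα hκβ,
    union_subset_union hαγ hβγ,
    (hF.smallOn_union h h').mono (fun s hs => ?_) le_rfl (add_halves ε).le⟩
  obtain ⟨hsγ, hsκ⟩ := hs
  rw [mem_union, not_or] at hsκ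
  exact hsγ.imp (⟨·, hsκ.1⟩) (⟨·, hsκ.2⟩)

theorem isSetAlgebra_isRegularFor (hF : IsCutoffSystem K F) (hℓ : IsExhaustive ℓ) :
    MeasureTheory.IsSetAlgebra {α | IsRegularFor K ℓ α} where
  empty_mem := hF.isRegularFor_of_isOpen hℓ isOpen_empty
  compl_mem := fun _ h => hF.isRegularFor_compl hℓ h
  union_mem := fun _ _ h h' => hF.isRegularFor_union h h'

theorem exists_disjoint_isOpen (hF : IsCutoffSystem K F) {κ γ : ℕ → Set S}
    (hκ : ∀ k, κ k ∈ K) (hγ : ∀ k, IsOpen (γ k)) (hκγ : ∀ k, κ k ⊆ γ k) :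
    ∃ β : ℕ → Set S, (∀ k, IsOpen (β k)) ∧ Pairwise (Disjoint on β) ∧
      ∀ k, κ k ⊆ β k ∪ ⋃ j ∈ Finset.range k, γ j := by
  choose w hw σ hσ hκw hwσ hσγ using fun k => hF.exists_open_between (hκ k) (hγ k) (hκγ k)
  refine ⟨fun k => w k \ ⋃ j ∈ Finset.range k, σ j, fun k =>
    (hw k).sdiff (isClosed_biUnion_finset fun j _ => hF.isClosed _ (hσ j)),
    (pairwise_disjoint_on _).2 fun i j hij => ?_, fun k s hs => ?_⟩
  · have hσi : σ i ⊆ ⋃ j' ∈ Finset.range j, σ j' :=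
      subset_biUnion_of_mem (u := σ) (Finset.mem_range.2 hij)
    exact (disjoint_sdiff_right.mono_left (sdiff_subset.trans ((hwσ i).trans hσi)))
  · by_cases hsσ : s ∈ ⋃ j ∈ Finset.range k, σ j
    · exact Or.inr (biUnion_mono Subset.rfl (fun j _ => hσγ j) hsσ)
    · exact Or.inl ⟨hκw k hs, hsσ⟩

theorem exists_smallOn (hF : IsCutoffSystem K F) (hℓ : IsExhaustive ℓ) (hp : Continuous p)
    (r : ℝ) (hε : 0 < ε) {α : ℕ → Set S} (hα : ∀ k, IsRegularFor K ℓ (α k))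
    (hd : Pairwise (Disjoint on α)) : ∃ k, SmallOn K ℓ p r ε (α k) := by
  by_contra! H
  choose κ hκ γ hγ hκα hαγ hsmall using fun k =>
    hα k p hp r (ε / 4 * (1 / 2) ^ k) (by positivity)
  obtain ⟨β, hβ, hβd, hκβ⟩ := hF.exists_disjoint_isOpen hκ hγ fun k => (hκα k).trans (hαγ k)
  have hcover (k) : α k ⊆ β k ∪ ⋃ j ∈ Finset.range (k + 1), γ j \ κ j := by
    intro s hs
    rw [Finset.range_add_one, Finset.set_biUnion_insert]
    by_cases hsκ : s ∈ κ k
    · refine (hκβ k hsκ).imp_right fun hsγ => Or.inr ?_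
      obtain ⟨j, hj, hsj⟩ := mem_iUnion₂.1 hsγ
      have hjk : Disjoint (α j) (α k) := hd (Finset.mem_range.1 hj).ne
      exact mem_biUnion hj ⟨hsj, fun hsκj => disjoint_left.1 hjk (hκα j hsκj) hs⟩
    · exact Or.inr (Or.inl ⟨hαγ k hs, hsκ⟩)
  have hsum (k) : ∑ j ∈ Finset.range (k + 1), ε / 4 * (1 / 2 : ℝ) ^ j ≤ ε / 2 := by
    rw [← Finset.mul_sum]
    nlinarith [sum_geometric_two_le (k + 1)]
  have hβ_not_small (k) : ¬SmallOn K ℓ p r (ε / 2) (β k) := fun hsmallβ =>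
    H k <| (hF.smallOn_union hsmallβ
      (hF.smallOn_biUnion (Finset.range (k + 1)) fun j _ => hsmall j)).mono (hcover k) le_rfl
        (by linarith [hsum k])
  choose f hf hfβ hpf using fun k => exists_lt_of_not_smallOn (hβ k) (hβ_not_small k)
  obtain ⟨k, hk⟩ := hℓ.exists_apply_le hp (half_pos hε) hf fun i j hij =>
    (hβd hij).mono (hfβ i).support_subset (hfβ j).support_subset
  exact hk.not_gt (hpf k)

theorem eventually_smallOn (hF : IsCutoffSystem K F) (hℓ : IsExhaustive ℓ) (hp : Continuous p)
    (r : ℝ) (hε : 0 < ε) {α : ℕ → Set S} (hα : ∀ k, IsRegularFor K ℓ (α k))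
    (hd : Pairwise (Disjoint on α)) : ∀ᶠ k in atTop, SmallOn K ℓ p r ε (α k) := by
  by_contra hnot
  obtain ⟨u, hu, hsmall⟩ := extraction_of_frequently_atTop (not_eventually.1 hnot)
  obtain ⟨k, hk⟩ := hF.exists_smallOn hℓ hp r hε (fun k => hα (u k))
    (hd.comp_of_injective hu.injective)
  exact hsmall k hk

end IsCutoffSystem

end SmallSets

/-! ### Cutoff functions with disjoint supports -/

section DisjointCutoffs

open scoped Function

variable {ι S X : Type*}

section Finite

variable [TopologicalSpace S] [NormedAddCommGroup X] [NormedSpace ℝ X] {K : Set (Set S)}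
  {F : Submodule ℝ (S → X)} {κ β : ι → Set S}

theorem IsCutoffSystem.exists_disjoint_cutoffs [Finite ι] (hF : IsCutoffSystem K F)
    (hκ : ∀ i, κ i ∈ K) (hd : Pairwise (Disjoint on κ)) (hβ : ∀ i, IsOpen (β i))
    (hκβ : ∀ i, κ i ⊆ β i) :
    ∃ φ : ι → S → ℝ, (∀ i, IsCutoff K F (κ i) (β i) (φ i)) ∧
      Pairwise (Disjoint on fun i => Function.support (φ i)) := by
  have hopen (i) : IsOpen (⋃ j, ⋃ _ : j ≠ i, κ j)ᶜ :=
    (isClosed_iUnion_of_finite fun j => isClosed_iUnion_of_finite fun _ =>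
      hF.isClosed _ (hκ j)).isOpen_compl
  have hdisj (i) : κ i ⊆ (⋃ j, ⋃ _ : j ≠ i, κ j)ᶜ := subset_compl_iff_disjoint_right.2 <|
    disjoint_iUnion₂_right.2 fun j hj => hd hj.symm
  choose w hw σ hσ hκw hwσ hσκ using fun i => hF.exists_open_between (hκ i) (hopen i) (hdisj i)
  let u : ι → Set S := fun i => w i \ ⋃ j, ⋃ _ : j ≠ i, σ j
  have hu (i) : IsOpen (u i) := (hw i).sdiff <| isClosed_iUnion_of_finite fun j =>
    isClosed_iUnion_of_finite fun _ => hF.isClosed _ (hσ j)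
  have hκu (i) : κ i ⊆ u i := fun s hs => by
    refine ⟨hκw i hs, fun hsσ => ?_⟩
    obtain ⟨j, hj, hsj⟩ := mem_iUnion₂.1 hsσ
    exact hσκ j hsj (mem_iUnion₂.2 ⟨i, hj.symm, hs⟩)
  have hud : Pairwise (Disjoint on u) := fun i j hij => disjoint_left.2 fun s hsi hsj =>
    hsj.2 (mem_iUnion₂.2 ⟨i, hij, hwσ i hsi.1⟩)
  choose φ hφ using fun i => hF.exists_cutoff (κ i) (hκ i) (β i ∩ u i) ((hβ i).inter (hu i))
    (subset_inter (hκβ i) (hκu i))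
  refine ⟨φ, fun i => { hφ i with supportedBy := (hφ i).supportedBy.mono inter_subset_left },
    fun i j hij => (hud hij).mono ?_ ?_⟩
  · exact (hφ i).supportedBy.support_subset.trans inter_subset_right
  · exact (hφ j).supportedBy.support_subset.trans inter_subset_right

end Finite

variable [Fintype ι]

theorem sum_apply_eq_of_mem_support {M : Type*} [AddCommMonoid M] {g : ι → S → M}
    (hg : Pairwise (Disjoint on fun i => Function.support (g i))) {i : ι} {s : S}
    (hi : s ∈ Function.support (g i)) : ∑ j, g j s = g i s :=
  Fintype.sum_eq_single i fun _ hj =>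
    Function.notMem_support.1 fun hjs => disjoint_left.1 (hg hj) hjs hi

theorem sum_apply_eq_zero_or_exists {M : Type*} [AddCommMonoid M] {g : ι → S → M}
    (hg : Pairwise (Disjoint on fun i => Function.support (g i))) (s : S) :
    ∑ i, g i s = 0 ∨ ∃ i, s ∈ Function.support (g i) ∧ ∑ j, g j s = g i s := by
  by_cases h : ∃ i, s ∈ Function.support (g i)
  · obtain ⟨i, hi⟩ := h
    exact Or.inr ⟨i, hi, sum_apply_eq_of_mem_support hg hi⟩
  · push Not at h
    exact Or.inl (Finset.sum_eq_zero fun i _ => Function.notMem_support.1 (h i))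

variable [TopologicalSpace S] [NormedAddCommGroup X] [NormedSpace ℝ X] {K : Set (Set S)}
  {F : Submodule ℝ (S → X)} {κ β : ι → Set S} {φ : ι → S → ℝ}

namespace IsCutoff

theorem norm_sum_smul_le (hφ : ∀ i, IsCutoff K F (κ i) (β i) (φ i))
    (hd : Pairwise (Disjoint on fun i => Function.support (φ i))) {C : ℝ} (hC : 0 ≤ C) (s : S)
    {u : ι → X} (hu : ∀ i, s ∈ β i → ‖u i‖ ≤ C) : ‖∑ i, φ i s • u i‖ ≤ C := by
  have hd' : Pairwise (Disjoint on fun i => Function.support fun t => φ i t • u i) :=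
    hd.mono fun i j hij => hij.mono (Function.support_smul_subset_left _ _)
      (Function.support_smul_subset_left _ _)
  rcases sum_apply_eq_zero_or_exists hd' s with h | ⟨i, hi, h⟩
  · rwa [h, norm_zero]
  · rw [h]
    have hsβ : s ∈ β i :=
      (hφ i).supportedBy.support_subset (Function.support_smul_subset_left _ _ hi)
    exact ((hφ i).norm_smul_le s _).trans (hu i hsβ)

theorem sum (hF : IsCutoffSystem K F) (hφ : ∀ i, IsCutoff K F (κ i) (β i) (φ i))
    (hd : Pairwise (Disjoint on fun i => Function.support (φ i))) :
    IsCutoff K F (⋃ i, κ i) (⋃ i, β i) (fun s => ∑ i, φ i s) where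
  mem_Icc s := by
    rcases sum_apply_eq_zero_or_exists hd s with h | ⟨i, -, h⟩
    · rw [h]
      exact left_mem_Icc.2 zero_le_one
    · rw [h]
      exact (hφ i).mem_Icc s
  eq_one := by
    choose w hw hκw hw1 using fun i => (hφ i).eq_one
    refine ⟨⋃ i, w i, isOpen_iUnion hw, iUnion_mono hκw, fun s hs => ?_⟩
    obtain ⟨i, hi⟩ := mem_iUnion.1 hs
    have hsi : s ∈ Function.support (φ i) := by
      rw [Function.mem_support, hw1 i s hi]
      exact one_ne_zero
    exact (sum_apply_eq_of_mem_support hd hsi).trans (hw1 i s hi)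
  supportedBy := by
    simpa only [Finset.sum_fn] using hF.supportedBy_sum Finset.univ fun i _ =>
      (hφ i).supportedBy.mono (subset_iUnion β i)
  const_mem x := by
    simpa only [Finset.sum_smul, Finset.sum_fn] using
      F.sum_mem fun i (_ : i ∈ Finset.univ) => (hφ i).const_mem x
  smul_mem f hf := by
    simpa only [Finset.sum_smul, Finset.sum_fn] using
      F.sum_mem fun i (_ : i ∈ Finset.univ) => (hφ i).smul_mem f hf

/-- The linear map `y ↦ ∑ i, φ i • y i` from families of constants into `F`. -/
def sumConst (hφ : ∀ i, IsCutoff K F (κ i) (β i) (φ i)) : (ι → X) →ₗ[ℝ] F :=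
  ∑ i, (hφ i).const ∘ₗ LinearMap.proj i

theorem sumConst_apply (hφ : ∀ i, IsCutoff K F (κ i) (β i) (φ i)) (y : ι → X) :
    sumConst hφ y = ∑ i, (hφ i).const (y i) := by
  rw [sumConst, LinearMap.sum_apply]
  rfl

theorem coe_sumConst_apply (hφ : ∀ i, IsCutoff K F (κ i) (β i) (φ i)) (y : ι → X) (s : S) :
    (sumConst hφ y : S → X) s = ∑ i, φ i s • y i := by
  rw [sumConst_apply, Submodule.coe_sum, Finset.sum_apply]
  rfl

theorem sumConst_const (hF : IsCutoffSystem K F) (hφ : ∀ i, IsCutoff K F (κ i) (β i) (φ i))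
    (hd : Pairwise (Disjoint on fun i => Function.support (φ i))) (x : X) :
    sumConst hφ (fun _ => x) = (sum hF hφ hd).const x :=
  Subtype.ext <| funext fun s => (coe_sumConst_apply hφ _ s).trans Finset.sum_smul.symm

theorem sumConst_mem_supBall (hφ : ∀ i, IsCutoff K F (κ i) (β i) (φ i))
    (hd : Pairwise (Disjoint on fun i => Function.support (φ i))) {C : ℝ} (hC : 0 ≤ C)
    {y : ι → X} (hy : ∀ i, ‖y i‖ ≤ C) : sumConst hφ y ∈ supBall F C := fun s => by
  rw [coe_sumConst_apply]
  exact norm_sum_smul_le hφ hd hC s fun i _ => hy i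

theorem sumConst_supportedBy (hF : IsCutoffSystem K F)
    (hφ : ∀ i, IsCutoff K F (κ i) (β i) (φ i)) (y : ι → X) :
    SupportedBy K (sumConst hφ y : S → X) (⋃ i, β i) := by
  rw [sumConst_apply, Submodule.coe_sum]
  exact hF.supportedBy_sum _ fun i _ => ((hφ i).smul_supportedBy fun _ => y i).mono
    (subset_iUnion β i)

end IsCutoff

end DisjointCutoffs

/-! ### The set functions generated by a linear map -/

section GeneratedSetFunctions

open scoped Function

variable {S X : Type*} [TopologicalSpace S] [NormedAddCommGroup X] [NormedSpace ℝ X]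
  {K : Set (Set S)} {F : Submodule ℝ (S → X)} {r ε : ℝ} {x : X} {κ κ' γ γ' : Set S}

/-- The functions in `F` that are bounded by `r`, equal `x` over `κ` and are supported by `γ`.
For open `γ ⊇ κ` these sets form the basis of the filter that defines `τ_ℓ(κ)(x)`, with the
ball of radius `r` as `B`. -/
def approximants (K : Set (Set S)) (F : Submodule ℝ (S → X)) (r : ℝ) (x : X) (κ γ : Set S) :
    Set F :=
  {f | f ∈ supBall F r ∧ EqualsOver {w : Set S | IsOpen w} (f : S → X) x κ ∧
    SupportedBy K (f : S → X) γ}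

theorem approximants_mono (hκ : κ ⊆ κ') (hγ : γ ⊆ γ') :
    approximants K F r x κ' γ ⊆ approximants K F r x κ γ' := by
  rintro f ⟨hf, ⟨w, hw, hκw, hwx⟩, hfγ⟩
  exact ⟨hf, ⟨w, hw, hκ.trans hκw, hwx⟩, hfγ.mono hγ⟩

theorem IsCutoff.const_mem_approximants {φ : S → ℝ} (hφ : IsCutoff K F κ γ φ) (hx : ‖x‖ ≤ r) :
    hφ.const x ∈ approximants K F r x κ γ := by
  obtain ⟨w, hw, hκw, hw1⟩ := hφ.eq_one
  refine ⟨hφ.const_mem_supBall hx, ⟨w, hw, hκw, fun s hs => ?_⟩, hφ.smul_supportedBy fun _ => x⟩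
  change φ s • x = x
  rw [hw1 s hs, one_smul]

theorem IsCutoffSystem.approximants_nonempty (hF : IsCutoffSystem K F) (hκ : κ ∈ K)
    (hγ : IsOpen γ) (hκγ : κ ⊆ γ) (hx : ‖x‖ ≤ r) : (approximants K F r x κ γ).Nonempty := by
  obtain ⟨φ, hφ⟩ := hF.exists_cutoff κ hκ γ hγ hκγ
  exact ⟨_, hφ.const_mem_approximants hx⟩

theorem hasBasis_approxFilter (x : X) (κ : Set S) (B : Set X) :
    (approxFilter K {γ : Set S | IsOpen γ} F x κ B).HasBasis (fun β => IsOpen β ∧ κ ⊆ β)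
      (fun β => {f : F | range (f : S → X) ⊆ B ∧
        EqualsOver {γ : Set S | IsOpen γ} (f : S → X) x κ ∧ SupportedBy K (f : S → X) β}) := by
  refine hasBasis_biInf_principal' ?_ ⟨univ, isOpen_univ, subset_univ _⟩
  rintro β ⟨hβ, hκβ⟩ β' ⟨hβ', hκβ'⟩
  exact ⟨β ∩ β', ⟨IsOpen.inter hβ hβ', subset_inter hκβ hκβ'⟩,
    fun f hf => ⟨hf.1, hf.2.1, hf.2.2.mono inter_subset_left⟩,
    fun f hf => ⟨hf.1, hf.2.1, hf.2.2.mono inter_subset_right⟩⟩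

theorem hasBasis_approxFilter_closedBall (r : ℝ) (x : X) (κ : Set S) :
    (approxFilter K {γ : Set S | IsOpen γ} F x κ (Metric.closedBall 0 r)).HasBasis
      (fun β => IsOpen β ∧ κ ⊆ β) (approximants K F r x κ) := by
  have h := hasBasis_approxFilter (K := K) (F := F) x κ (Metric.closedBall 0 r)
  simp only [range_subset_iff, mem_closedBall_zero_iff] at h
  exact h

theorem approxFilter_mono {A B : Set X} (h : A ⊆ B) :
    approxFilter K {γ : Set S | IsOpen γ} F x κ A ≤
      approxFilter K {γ : Set S | IsOpen γ} F x κ B :=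
  iInf₂_mono fun _ _ => principal_mono.2 fun _ hf => ⟨hf.1.trans h, hf.2⟩

theorem smul_mem_hull (x : X) {t : ℝ} (ht : t ∈ Icc (0 : ℝ) 1) :
    t • x ∈ hull (closedBalancedTotallyBounded X) x := by
  rintro B ⟨hB, hx⟩
  exact hB.2.2.1 t ((Real.norm_of_nonneg ht.1).trans_le ht.2) (smul_mem_smul_set hx)

theorem IsCutoffSystem.neBot_approxFilter (hF : IsCutoffSystem K F) (hκ : κ ∈ K) {B : Set X}
    (hB : hull (closedBalancedTotallyBounded X) x ⊆ B) :
    (approxFilter K {γ : Set S | IsOpen γ} F x κ B).NeBot := by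
  refine (hasBasis_approxFilter x κ B).neBot_iff.2 ?_
  rintro β ⟨hβ, hκβ⟩
  obtain ⟨φ, hφ⟩ := hF.exists_cutoff κ hκ β hβ hκβ
  refine ⟨hφ.const x, range_subset_iff.2 fun s => hB (smul_mem_hull x (hφ.mem_Icc s)), ?_⟩
  exact (hφ.const_mem_approximants le_rfl).2

section ProperSpace

variable [ProperSpace X]

theorem closedBall_mem_closedBalancedTotallyBounded (hr : 0 ≤ r) :
    Metric.closedBall (0 : X) r ∈ closedBalancedTotallyBounded X :=
  ⟨⟨0, Metric.mem_closedBall_self hr⟩, Metric.isClosed_closedBall, balanced_closedBall_zero,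
    (isCompact_closedBall 0 r).totallyBounded⟩

theorem hull_subset_closedBall (hx : ‖x‖ ≤ r) :
    hull (closedBalancedTotallyBounded X) x ⊆ Metric.closedBall 0 r :=
  sInter_subset_of_mem
    ⟨closedBall_mem_closedBalancedTotallyBounded ((norm_nonneg x).trans hx),
      mem_closedBall_zero_iff.2 hx⟩

end ProperSpace

theorem exists_norm_le_of_mem_closedBalancedTotallyBounded {B : Set X}
    (hB : B ∈ closedBalancedTotallyBounded X) : ∃ r, 0 ≤ r ∧ ∀ x ∈ B, ‖x‖ ≤ r := by
  obtain ⟨r, hr⟩ := hB.2.2.2.isBounded.subset_closedBall 0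
  exact ⟨max r 0, le_max_right _ _, fun x hx =>
    (mem_closedBall_zero_iff.1 (hr hx)).trans (le_max_left _ _)⟩

theorem IsCutoffSystem.neBot_atTop_inner (hF : IsCutoffSystem K F) (γ : Set S) :
    (atTop : Filter {κ : Set S // κ ∈ K ∧ κ ⊆ γ}).NeBot := by
  have : Nonempty {κ : Set S // κ ∈ K ∧ κ ⊆ γ} := ⟨⟨∅, hF.empty_mem, empty_subset _⟩⟩
  have : IsDirectedOrder {κ : Set S // κ ∈ K ∧ κ ⊆ γ} :=
    ⟨fun a b => ⟨⟨a.1 ∪ b.1, hF.union_mem _ a.2.1 _ b.2.1, union_subset a.2.2 b.2.2⟩,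
      (subset_union_left : a.1 ⊆ a.1 ∪ b.1), (subset_union_right : b.1 ⊆ a.1 ∪ b.1)⟩⟩
  exact atTop_neBot

theorem neBot_atBot_outer (α : Set S) :
    (atBot : Filter {γ : Set S // γ ∈ {γ : Set S | IsOpen γ} ∧ α ⊆ γ}).NeBot := by
  have : Nonempty {γ : Set S // γ ∈ {γ : Set S | IsOpen γ} ∧ α ⊆ γ} :=
    ⟨⟨univ, isOpen_univ, subset_univ _⟩⟩
  have : IsCodirectedOrder {γ : Set S // γ ∈ {γ : Set S | IsOpen γ} ∧ α ⊆ γ} :=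
    ⟨fun a b => ⟨⟨a.1 ∩ b.1, IsOpen.inter a.2.1 b.2.1, subset_inter a.2.2 b.2.2⟩,
      (inter_subset_left : a.1 ∩ b.1 ⊆ a.1), (inter_subset_right : a.1 ∩ b.1 ⊆ b.1)⟩⟩
  exact atBot_neBot

variable {Z : Type*} [AddCommGroup Z] [Module ℝ Z]

theorem IsCutoffSystem.apply_sub_apply_le (hF : IsCutoffSystem K F) {ℓ : F →ₗ[ℝ] Z}
    {p : AddGroupSeminorm Z} (h : SmallOn K ℓ p (2 * r) ε (γ \ κ)) {f g : F}
    (hf : f ∈ approximants K F r x κ γ) (hg : g ∈ approximants K F r x κ γ) :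
    p (ℓ f - ℓ g) ≤ ε := by
  obtain ⟨hfr, ⟨w, hw, hκw, hfw⟩, hfγ⟩ := hf
  obtain ⟨hgr, ⟨w', hw', hκw', hgw⟩, hgγ⟩ := hg
  rw [← map_sub]
  refine h.le (fun s => ?_) (hF.supportedBy_of_eq_zero (w := w ∩ w')
    (hF.supportedBy_sub hfγ hgγ) (IsOpen.inter hw hw') (fun s hs => ?_)
    (sdiff_subset_sdiff_right (subset_inter hκw hκw')))
  · exact (norm_sub_le_of_le (hfr s) (hgr s)).trans_eq (two_mul r).symm
  · rw [Submodule.coe_sub, Pi.sub_apply, hfw s hs.1, hgw s hs.2, sub_self]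

variable [UniformSpace Z]

/-- `τ_ℓ` for the open sets and the closed balanced totally bounded sets. -/
noncomputable abbrev rieszTau (K : Set (Set S)) (ℓ : F →ₗ[ℝ] Z) (κ : Set S) (x : X) : Z :=
  tauOf K {γ : Set S | IsOpen γ} (closedBalancedTotallyBounded X) F ℓ κ x

/-- `ξ_ℓ` for the open sets and the closed balanced totally bounded sets. -/
noncomputable abbrev rieszXi (K : Set (Set S)) (ℓ : F →ₗ[ℝ] Z) (γ : Set S) (x : X) : Z :=
  xiOf K {γ : Set S | IsOpen γ} (closedBalancedTotallyBounded X) F ℓ γ x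

/-- `ν_ℓ` for the open sets and the closed balanced totally bounded sets. -/
noncomputable abbrev rieszNu (K : Set (Set S)) (ℓ : F →ₗ[ℝ] Z) (α : Set S) (x : X) : Z :=
  nuOf K {γ : Set S | IsOpen γ} (closedBalancedTotallyBounded X) F ℓ α x

variable [ProperSpace X] [IsUniformAddGroup Z] [T2Space Z] {ℓ : F →ₗ[ℝ] Z}
  {p : AddGroupSeminorm Z} {α : Set S}

namespace IsCutoffSystem

theorem tendsto_rieszTau_closedBall (hF : IsCutoffSystem K F) (hℓ : IsExhaustive ℓ) (hκ : κ ∈ K)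
    (hx : ‖x‖ ≤ r) :
    Tendsto ℓ (approxFilter K {γ : Set S | IsOpen γ} F x κ (Metric.closedBall 0 r))
      (𝓝 (rieszTau K ℓ κ x)) := by
  have hb := hasBasis_approxFilter_closedBall (K := K) (F := F) r x κ
  have hhull := hull_subset_closedBall hx
  have := hF.neBot_approxFilter hκ hhull
  have := hF.neBot_approxFilter hκ (x := x) Subset.rfl
  have hbounded : ∀ᶠ f in approxFilter K {γ : Set S | IsOpen γ} F x κ (Metric.closedBall 0 r),
      ℓ f ∈ closure (ℓ '' supBall F r) := by
    filter_upwards [hb.mem_of_mem ⟨isOpen_univ, subset_univ _⟩] with f hf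
    exact subset_closure (mem_image_of_mem ℓ hf.1)
  have hcauchy : ∀ p : AddGroupSeminorm Z, Continuous p → ∀ ε > 0, ∃ z,
      ∀ᶠ f in approxFilter K {γ : Set S | IsOpen γ} F x κ (Metric.closedBall 0 r),
        p (z - ℓ f) ≤ ε := by
    intro p hp ε hε
    obtain ⟨β, hβ, hκβ, h⟩ := hF.exists_outer hℓ hp (2 * r) hε hκ
    obtain ⟨g, hg⟩ := hF.approximants_nonempty hκ hβ hκβ hx
    refine ⟨ℓ g, ?_⟩
    filter_upwards [hb.mem_of_mem ⟨hβ, hκβ⟩] with f hf using hF.apply_sub_apply_le h hg hf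
  obtain ⟨z, -, hz⟩ := exists_tendsto_of_addGroupSeminorm (hℓ.relativelyComplete r) hbounded hcauchy
  have hτ : rieszTau K ℓ κ x = z := (hz.mono_left (approxFilter_mono hhull)).limUnder_eq
  rwa [hτ]

theorem tendsto_rieszTau (hF : IsCutoffSystem K F) (hℓ : IsExhaustive ℓ) (hκ : κ ∈ K) {B : Set X}
    (hB : B ∈ closedBalancedTotallyBounded X) (hx : x ∈ B) :
    Tendsto ℓ (approxFilter K {γ : Set S | IsOpen γ} F x κ B) (𝓝 (rieszTau K ℓ κ x)) := by
  obtain ⟨r, -, hr⟩ := exists_norm_le_of_mem_closedBalancedTotallyBounded hB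
  exact (hF.tendsto_rieszTau_closedBall hℓ hκ (hr x hx)).mono_left
    (approxFilter_mono fun y hy => mem_closedBall_zero_iff.2 (hr y hy))

theorem rieszTau_sub_le (hF : IsCutoffSystem K F) (hℓ : IsExhaustive ℓ) (hp : Continuous p)
    (hκ' : κ' ∈ K) (hx : ‖x‖ ≤ r) (hγ : IsOpen γ) (hκκ' : κ ⊆ κ') (hκγ : κ' ⊆ γ)
    (h : SmallOn K ℓ p (2 * r) ε (γ \ κ)) {f : F} (hf : f ∈ approximants K F r x κ γ) :
    p (rieszTau K ℓ κ' x - ℓ f) ≤ ε := by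
  have := hF.neBot_approxFilter hκ' (hull_subset_closedBall hx)
  refine le_of_tendsto ((hp.tendsto _).comp
    ((hF.tendsto_rieszTau_closedBall hℓ hκ' hx).sub_const (ℓ f))) ?_
  filter_upwards [(hasBasis_approxFilter_closedBall r x κ').mem_of_mem ⟨hγ, hκγ⟩] with g hg
  exact hF.apply_sub_apply_le h (approximants_mono hκκ' Subset.rfl hg) hf

theorem rieszTau_mem_closure (hF : IsCutoffSystem K F) (hℓ : IsExhaustive ℓ) (hκ : κ ∈ K)
    (hx : ‖x‖ ≤ r) : rieszTau K ℓ κ x ∈ closure (ℓ '' supBall F r) := by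
  have := hF.neBot_approxFilter hκ (hull_subset_closedBall hx)
  refine mem_closure_of_tendsto (hF.tendsto_rieszTau_closedBall hℓ hκ hx) ?_
  filter_upwards [(hasBasis_approxFilter_closedBall r x κ).mem_of_mem
    ⟨isOpen_univ, subset_univ _⟩] with f hf using mem_image_of_mem ℓ hf.1

theorem tendsto_rieszXi (hF : IsCutoffSystem K F) (hℓ : IsExhaustive ℓ) (hγ : IsOpen γ) (x : X) :
    Tendsto (fun κ : {κ : Set S // κ ∈ K ∧ κ ⊆ γ} => rieszTau K ℓ κ x) atTop
      (𝓝 (rieszXi K ℓ γ x)) := by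
  have := hF.neBot_atTop_inner γ
  obtain ⟨z, -, hz⟩ := exists_tendsto_of_addGroupSeminorm (hℓ.relativelyComplete ‖x‖)
    (Eventually.of_forall fun κ : {κ : Set S // κ ∈ K ∧ κ ⊆ γ} =>
      hF.rieszTau_mem_closure hℓ κ.2.1 le_rfl) fun p hp ε hε => by
    obtain ⟨κ, hκ, hκγ, h⟩ := hF.exists_inner hℓ hp (2 * ‖x‖) hε hγ
    obtain ⟨f, hf⟩ := hF.approximants_nonempty hκ hγ hκγ (le_refl ‖x‖)
    refine ⟨ℓ f, ?_⟩
    filter_upwards [eventually_ge_atTop ⟨κ, hκ, hκγ⟩] with κ' hκ'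
    rw [map_sub_rev]
    exact hF.rieszTau_sub_le hℓ hp κ'.2.1 le_rfl hγ hκ' κ'.2.2 h hf
  exact tendsto_nhds_limUnder ⟨z, hz⟩

theorem rieszXi_sub_le (hF : IsCutoffSystem K F) (hℓ : IsExhaustive ℓ) (hp : Continuous p)
    (hκ : κ ∈ K) (hx : ‖x‖ ≤ r) (hγ : IsOpen γ) (hγ' : IsOpen γ') (hκγ' : κ ⊆ γ')
    (hγγ' : γ' ⊆ γ) (h : SmallOn K ℓ p (2 * r) ε (γ \ κ)) {f : F}
    (hf : f ∈ approximants K F r x κ γ) : p (rieszXi K ℓ γ' x - ℓ f) ≤ ε := by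
  have := hF.neBot_atTop_inner γ'
  refine le_of_tendsto ((hp.tendsto _).comp
    ((hF.tendsto_rieszXi hℓ hγ' x).sub_const (ℓ f))) ?_
  filter_upwards [eventually_ge_atTop ⟨κ, hκ, hκγ'⟩] with κ' hκ'
  exact hF.rieszTau_sub_le hℓ hp κ'.2.1 hx hγ hκ' (κ'.2.2.trans hγγ') h hf

theorem rieszXi_mem_closure (hF : IsCutoffSystem K F) (hℓ : IsExhaustive ℓ) (hγ : IsOpen γ)
    (hx : ‖x‖ ≤ r) : rieszXi K ℓ γ x ∈ closure (ℓ '' supBall F r) := by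
  have := hF.neBot_atTop_inner γ
  exact isClosed_closure.mem_of_tendsto (hF.tendsto_rieszXi hℓ hγ x)
    (Eventually.of_forall fun κ => hF.rieszTau_mem_closure hℓ κ.2.1 hx)

theorem rieszXi_sub_rieszXi_le (hF : IsCutoffSystem K F) (hℓ : IsExhaustive ℓ)
    (hp : Continuous p) (hε : 0 < ε) (hγ : IsOpen γ) (hγ' : IsOpen γ') (hγγ' : γ' ⊆ γ)
    (h : SmallOn K ℓ p (2 * ‖x‖) ε (γ \ γ')) :
    p (rieszXi K ℓ γ x - rieszXi K ℓ γ' x) ≤ 3 * ε := by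
  obtain ⟨κ, hκ, hκγ', h'⟩ := hF.exists_inner hℓ hp (2 * ‖x‖) hε hγ'
  obtain ⟨f, hf⟩ := hF.approximants_nonempty hκ hγ' hκγ' (le_refl ‖x‖)
  have hγκ : SmallOn K ℓ p (2 * ‖x‖) (ε + ε) (γ \ κ) :=
    (hF.smallOn_union h h').mono (sdiff_triangle γ γ' κ) le_rfl le_rfl
  have hξγ : p (rieszXi K ℓ γ x - ℓ f) ≤ ε + ε :=
    hF.rieszXi_sub_le hℓ hp hκ le_rfl hγ hγ (hκγ'.trans hγγ') Subset.rfl hγκ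
      (approximants_mono Subset.rfl hγγ' hf)
  have hξγ' : p (rieszXi K ℓ γ' x - ℓ f) ≤ ε :=
    hF.rieszXi_sub_le hℓ hp hκ le_rfl hγ' hγ' hκγ' Subset.rfl h' hf
  linarith [map_sub_le_of_sub_le hξγ hξγ']

-- Otherwise there is a decreasing sequence of open sets along which `ξ_ℓ` oscillates, although its
-- successive differences are disjoint regular sets.
theorem exists_rieszXi_sub_rieszXi_le (hF : IsCutoffSystem K F) (hℓ : IsExhaustive ℓ)
    (hp : Continuous p) (hε : 0 < ε) (α : Set S) (x : X) :
    ∃ γ, IsOpen γ ∧ α ⊆ γ ∧ ∀ γ', IsOpen γ' → α ⊆ γ' → γ' ⊆ γ →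
      p (rieszXi K ℓ γ x - rieszXi K ℓ γ' x) ≤ ε := by
  by_contra! H
  have step : ∀ γ : {γ : Set S // IsOpen γ ∧ α ⊆ γ}, ∃ γ' : {γ : Set S // IsOpen γ ∧ α ⊆ γ},
      γ' ≤ γ ∧ ε < p (rieszXi K ℓ γ x - rieszXi K ℓ γ' x) := by
    rintro ⟨γ, hγ, hαγ⟩
    obtain ⟨γ', hγ', hαγ', hle, h⟩ := H γ hγ hαγ
    exact ⟨⟨γ', hγ', hαγ'⟩, hle, h⟩
  choose next next_le hnext using step
  let γ : ℕ → {γ : Set S // IsOpen γ ∧ α ⊆ γ} := fun n =>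
    next^[n] ⟨univ, isOpen_univ, subset_univ _⟩
  have γ_succ (n) : γ (n + 1) = next (γ n) := Function.iterate_succ_apply' _ _ _
  have γ_anti : Antitone γ := antitone_nat_of_succ_le fun n =>
    (γ_succ n).le.trans (next_le (γ n))
  have hreg (k) : IsRegularFor K ℓ ((γ k).1 \ (γ (k + 1)).1) :=
    (hF.isSetAlgebra_isRegularFor hℓ).sdiff_mem (hF.isRegularFor_of_isOpen hℓ (γ k).2.1)
      (hF.isRegularFor_of_isOpen hℓ (γ (k + 1)).2.1)
  have hd : Pairwise (Disjoint on fun k => (γ k).1 \ (γ (k + 1)).1) :=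
    (pairwise_disjoint_on _).2 fun i j hij =>
      disjoint_sdiff_left.mono_right (sdiff_subset.trans (γ_anti (Nat.succ_le_of_lt hij)))
  obtain ⟨k, hk⟩ := hF.exists_smallOn hℓ hp (2 * ‖x‖) (div_pos hε three_pos) hreg hd
  have hle := hF.rieszXi_sub_rieszXi_le hℓ hp (div_pos hε three_pos) (γ k).2.1 (γ (k + 1)).2.1
    (γ_anti k.le_succ) hk
  have hlt := hnext (γ k)
  rw [← γ_succ] at hlt
  linarith

theorem tendsto_rieszNu (hF : IsCutoffSystem K F) (hℓ : IsExhaustive ℓ) (α : Set S) (x : X) :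
    Tendsto (fun γ : {γ : Set S // γ ∈ {γ : Set S | IsOpen γ} ∧ α ⊆ γ} => rieszXi K ℓ γ x) atBot
      (𝓝 (rieszNu K ℓ α x)) := by
  have := neBot_atBot_outer α
  obtain ⟨z, -, hz⟩ := exists_tendsto_of_addGroupSeminorm (hℓ.relativelyComplete ‖x‖)
    (Eventually.of_forall fun γ : {γ : Set S // γ ∈ {γ : Set S | IsOpen γ} ∧ α ⊆ γ} =>
      hF.rieszXi_mem_closure hℓ γ.2.1 le_rfl) fun p hp ε hε => by
    obtain ⟨γ, hγ, hαγ, h⟩ := hF.exists_rieszXi_sub_rieszXi_le hℓ hp hε α x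
    refine ⟨rieszXi K ℓ γ x, ?_⟩
    filter_upwards [eventually_le_atBot ⟨γ, hγ, hαγ⟩] with γ' hγ'
    exact h γ' γ'.2.1 γ'.2.2 hγ'
  exact tendsto_nhds_limUnder ⟨z, hz⟩

theorem rieszNu_sub_le (hF : IsCutoffSystem K F) (hℓ : IsExhaustive ℓ) (hp : Continuous p)
    (hκ : κ ∈ K) (hx : ‖x‖ ≤ r) (hγ : IsOpen γ) (hκα : κ ⊆ α) (hαγ : α ⊆ γ)
    (h : SmallOn K ℓ p (2 * r) ε (γ \ κ)) {f : F} (hf : f ∈ approximants K F r x κ γ) :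
    p (rieszNu K ℓ α x - ℓ f) ≤ ε := by
  have := neBot_atBot_outer α
  refine le_of_tendsto ((hp.tendsto _).comp
    ((hF.tendsto_rieszNu hℓ α x).sub_const (ℓ f))) ?_
  filter_upwards [eventually_le_atBot ⟨γ, hγ, hαγ⟩] with γ' hγ'
  exact hF.rieszXi_sub_le hℓ hp hκ hx hγ γ'.2.1 (hκα.trans γ'.2.2) hγ' h hf

theorem rieszNu_eq_rieszTau (hF : IsCutoffSystem K F) (hℓ : IsExhaustive ℓ) (hκ : κ ∈ K) (x : X) :
    rieszNu K ℓ κ x = rieszTau K ℓ κ x :=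
  Eq.symm <| eq_of_addGroupSeminorm fun p hp ε hε => by
    obtain ⟨β, hβ, hκβ, h⟩ := hF.exists_outer hℓ hp (2 * ‖x‖) (half_pos hε) hκ
    obtain ⟨f, hf⟩ := hF.approximants_nonempty hκ hβ hκβ (le_refl ‖x‖)
    exact (map_sub_le_of_sub_le (hF.rieszNu_sub_le hℓ hp hκ le_rfl hβ Subset.rfl hκβ h hf)
      (hF.rieszTau_sub_le hℓ hp hκ le_rfl hβ Subset.rfl hκβ h hf)).trans_eq (add_halves ε)

theorem rieszNu_eq_rieszXi (hF : IsCutoffSystem K F) (hℓ : IsExhaustive ℓ) (hγ : IsOpen γ) (x : X) :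
    rieszNu K ℓ γ x = rieszXi K ℓ γ x :=
  Eq.symm <| eq_of_addGroupSeminorm fun p hp ε hε => by
    obtain ⟨κ, hκ, hκγ, h⟩ := hF.exists_inner hℓ hp (2 * ‖x‖) (half_pos hε) hγ
    obtain ⟨f, hf⟩ := hF.approximants_nonempty hκ hγ hκγ (le_refl ‖x‖)
    exact (map_sub_le_of_sub_le (hF.rieszNu_sub_le hℓ hp hκ le_rfl hγ hκγ Subset.rfl h hf)
      (hF.rieszXi_sub_le hℓ hp hκ le_rfl hγ hγ hκγ Subset.rfl h hf)).trans_eq (add_halves ε)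

end IsCutoffSystem

end GeneratedSetFunctions

/-! ### Cutoff approximations of regular families -/

section CutoffApproximations

open scoped Function

variable {ι S X Z : Type*} [TopologicalSpace S] [NormedAddCommGroup X] [NormedSpace ℝ X]
  [AddCommGroup Z] [Module ℝ Z] [UniformSpace Z] {K : Set (Set S)} {F : Submodule ℝ (S → X)}
  {ℓ : F →ₗ[ℝ] Z} {p : AddGroupSeminorm Z} {r ε : ℝ} {ρ β κ : ι → Set S} {φ : ι → S → ℝ}

namespace IsCutoffSystem

theorem iUnion_mem [Finite ι] (hF : IsCutoffSystem K F) (hκ : ∀ i, κ i ∈ K) : ⋃ i, κ i ∈ K := by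
  cases nonempty_fintype ι
  rw [← iSup_eq_iUnion, ← Finset.sup_univ_eq_iSup]
  exact Finset.sup_mem K hF.empty_mem hF.union_mem Finset.univ κ fun i _ => hκ i

theorem isRegularFor_iUnion [Finite ι] (hF : IsCutoffSystem K F) (hℓ : IsExhaustive ℓ)
    (hρ : ∀ i, IsRegularFor K ℓ (ρ i)) : IsRegularFor K ℓ (⋃ i, ρ i) := by
  cases nonempty_fintype ι
  have halg := hF.isSetAlgebra_isRegularFor hℓ
  rw [← iSup_eq_iUnion, ← Finset.sup_univ_eq_iSup]
  exact Finset.sup_mem {α | IsRegularFor K ℓ α} halg.empty_mem (fun _ hα _ => halg.union_mem hα)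
    Finset.univ ρ fun i _ => hρ i

end IsCutoffSystem

variable [Fintype ι]

/-- The `φ i` are cutoff functions with disjoint supports for sets `κ i ⊆ ρ i` that exhaust the
`ρ i` up to a small set. For all families `y` of vectors of norm at most `r`, the value of `ℓ` at
`∑ i, φ i • y i` is `ε`-close to the sums `∑ i, ν_ℓ(α i)(y i)` with `κ i ⊆ α i ⊆ ρ i`. -/
structure IsCutoffApproximation (K : Set (Set S)) (ℓ : F →ₗ[ℝ] Z) (p : AddGroupSeminorm Z)
    (r ε : ℝ) (ρ β κ : ι → Set S) (φ : ι → S → ℝ) : Prop where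
  isCutoff : ∀ i, IsCutoff K F (κ i) (β i) (φ i)
  disjoint_support : Pairwise (Disjoint on fun i => Function.support (φ i))
  mem : ∀ i, κ i ∈ K
  subset : ∀ i, κ i ⊆ ρ i
  smallOn : SmallOn K ℓ p r ε (⋃ i, ρ i \ κ i)
  sum_sub_le : ∀ α : ι → Set S, (∀ i, κ i ⊆ α i) → (∀ i, α i ⊆ ρ i) → ∀ y : ι → X,
    (∀ i, ‖y i‖ ≤ r) →
      p (∑ i, rieszNu K ℓ (α i) (y i) - ℓ (IsCutoff.sumConst isCutoff y)) ≤ ε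

namespace IsCutoffApproximation

theorem sum_sub_sum_le (h : IsCutoffApproximation K ℓ p r ε ρ β κ φ) {x y : ι → X} {ε' : ℝ}
    (hx : ∀ i, ‖x i‖ ≤ r) (hy : ∀ i, ‖y i‖ ≤ r)
    (hxy : p (ℓ (IsCutoff.sumConst h.isCutoff (y - x))) ≤ ε') :
    p (∑ i, rieszNu K ℓ (ρ i) (y i) - ∑ i, rieszNu K ℓ (ρ i) (x i)) ≤ ε + ε' + ε := by
  have hle := h.sum_sub_le ρ h.subset fun _ => Subset.rfl
  rw [map_sub, map_sub, map_sub_rev] at hxy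
  refine map_sub_le_of_sub_le (hle y hy) ?_ |>.trans_eq (add_assoc _ _ _).symm
  linarith [le_map_sub_add_map_sub p (∑ i, rieszNu K ℓ (ρ i) (x i))
    (ℓ (IsCutoff.sumConst h.isCutoff x)) (ℓ (IsCutoff.sumConst h.isCutoff y)), hle x hx]

-- With `Φ = ∑ i, φ i`, the function `f - Φ f` is supported by the small set `⋃ i, ρ i \ κ i`, and
-- `Φ f - ∑ i, φ i • y i` is uniformly small.
theorem apply_sub_sumConst_le (h : IsCutoffApproximation K ℓ p r ε ρ β κ φ)
    (hF : IsCutoffSystem K F) {f : F} (hf : f ∈ supBall F r)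
    (hfρ : SupportedBy K (f : S → X) (⋃ i, ρ i)) {δ : ℝ} (hδ : 0 ≤ δ)
    (hδℓ : ∀ g ∈ supBall F δ, p (ℓ g) ≤ ε) {y : ι → X}
    (hy : ∀ i, ∀ s ∈ β i, ‖(f : S → X) s - y i‖ ≤ δ) :
    p (ℓ f - ℓ (IsCutoff.sumConst h.isCutoff y)) ≤ ε + ε := by
  have hΦ := IsCutoff.sum hF h.isCutoff h.disjoint_support
  have hsubset : (⋃ i, ρ i) \ ⋃ i, κ i ⊆ ⋃ i, ρ i \ κ i := by
    rw [iUnion_sdiff]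
    exact iUnion_mono fun i => sdiff_subset_sdiff_right (subset_iUnion κ i)
  have hsmall : p (ℓ (f - hΦ.mul f)) ≤ ε :=
    h.smallOn.le (hΦ.sub_mul_mem_supBall hf) ((hF.supportedBy_sub_mul hΦ hfρ).mono hsubset)
  have hclose : p (ℓ (hΦ.mul f - IsCutoff.sumConst h.isCutoff y)) ≤ ε := by
    refine hδℓ _ fun s => ?_
    have hs : ((hΦ.mul f - IsCutoff.sumConst h.isCutoff y : F) : S → X) s =
        ∑ i, φ i s • ((f : S → X) s - y i) := by
      rw [Submodule.coe_sub, Pi.sub_apply, IsCutoff.coe_sumConst_apply]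
      simp only [smul_sub, Finset.sum_sub_distrib, ← Finset.sum_smul]
      rfl
    rw [hs]
    exact IsCutoff.norm_sum_smul_le h.isCutoff h.disjoint_support hδ s fun i => hy i s
  rw [map_sub] at hsmall hclose
  exact (le_map_sub_add_map_sub p _ _ _).trans (add_le_add hsmall hclose)

theorem apply_sub_sum_le (h : IsCutoffApproximation K ℓ p r ε ρ β κ φ)
    (hF : IsCutoffSystem K F) {f : F} (hf : f ∈ supBall F r)
    (hfρ : SupportedBy K (f : S → X) (⋃ i, ρ i)) {δ : ℝ} (hδ : 0 ≤ δ)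
    (hδℓ : ∀ g ∈ supBall F δ, p (ℓ g) ≤ ε) {y : ι → X}
    (hy : ∀ i, ∀ s ∈ β i, ‖(f : S → X) s - y i‖ ≤ δ) (hyr : ∀ i, ‖y i‖ ≤ r) {α : ι → Set S}
    (hκα : ∀ i, κ i ⊆ α i) (hαρ : ∀ i, α i ⊆ ρ i) :
    p (ℓ f - ∑ i, rieszNu K ℓ (α i) (y i)) ≤ ε + ε + ε :=
  map_sub_le_of_sub_le (h.apply_sub_sumConst_le hF hf hfρ hδ hδℓ hy) (h.sum_sub_le α hκα hαρ y hyr)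

end IsCutoffApproximation

namespace IsCutoffSystem

variable [ProperSpace X] [IsUniformAddGroup Z] [T2Space Z]

theorem exists_isCutoffApproximation (hF : IsCutoffSystem K F) (hℓ : IsExhaustive ℓ)
    (hp : Continuous p) (hr : 0 ≤ r) (hε : 0 < ε) (hρ : ∀ i, IsRegularFor K ℓ (ρ i))
    (hd : Pairwise (Disjoint on ρ)) (hβ : ∀ i, IsOpen (β i)) (hρβ : ∀ i, ρ i ⊆ β i) :
    ∃ κ φ, IsCutoffApproximation K ℓ p r ε ρ β κ φ := by
  obtain ⟨η, hη, hle⟩ := exists_pos_mul_lt hε (Fintype.card ι)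
  have hsum : ∑ _i : ι, η ≤ ε := by
    rw [Finset.sum_const, Finset.card_univ, nsmul_eq_mul]
    exact hle.le
  choose κ hκ γ hγ hκρ hργ hsmall using fun i => hρ i p hp (2 * r) η hη
  obtain ⟨φ, hφ, hφd⟩ := hF.exists_disjoint_cutoffs hκ
    (hd.mono fun i j hij => hij.mono (hκρ i) (hκρ j)) (fun i => (hβ i).inter (hγ i))
    fun i => (hκρ i).trans (subset_inter (hρβ i) (hργ i))
  refine ⟨κ, φ, fun i => { hφ i with supportedBy := (hφ i).supportedBy.mono inter_subset_left },
    hφd, hκ, hκρ, ?_, fun α hκα hαρ y hy => ?_⟩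
  · have h := hF.smallOn_biUnion Finset.univ fun i _ => (hsmall i).mono
      (sdiff_subset_sdiff_left (hργ i)) (by linarith : r ≤ 2 * r) le_rfl
    exact h.mono (by simp only [Finset.mem_univ, iUnion_true, Subset.rfl]) le_rfl hsum
  · rw [IsCutoff.sumConst_apply, map_sum]
    refine (map_sum_sub_sum_le p _ _ _).trans ((Finset.sum_le_sum fun i _ => ?_).trans hsum)
    exact hF.rieszNu_sub_le hℓ hp (hκ i) (hy i) (hγ i) (hκα i) ((hαρ i).trans (hργ i)) (hsmall i)
      (approximants_mono Subset.rfl inter_subset_right ((hφ i).const_mem_approximants (hy i)))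

theorem rieszNu_iUnion (hF : IsCutoffSystem K F) (hℓ : IsExhaustive ℓ)
    (hρ : ∀ i, IsRegularFor K ℓ (ρ i)) (hd : Pairwise (Disjoint on ρ)) (x : X) :
    rieszNu K ℓ (⋃ i, ρ i) x = ∑ i, rieszNu K ℓ (ρ i) x :=
  Eq.symm <| eq_of_addGroupSeminorm fun p hp ε hε => by
    have hr : ‖x‖ ≤ 2 * ‖x‖ := by linarith [norm_nonneg x]
    obtain ⟨κ₀, -, γ, hγ, hκ₀, hργ, hsmall⟩ := hF.isRegularFor_iUnion hℓ hρ p hp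
      (2 * ‖x‖) (ε / 3) (by positivity)
    obtain ⟨κ, φ, h⟩ := hF.exists_isCutoffApproximation hℓ hp ((norm_nonneg x).trans hr)
      (by positivity : 0 < ε / 3) hρ hd (fun _ => hγ) fun i => (subset_iUnion ρ i).trans hργ
    have hκρ : ⋃ i, κ i ⊆ ⋃ i, ρ i := iUnion_mono h.subset
    have hγκ : γ \ ⋃ i, κ i ⊆ (γ \ κ₀) ∪ ⋃ i, ρ i \ κ i := by
      rintro s ⟨hsγ, hsκ⟩
      by_cases hs : s ∈ κ₀
      · obtain ⟨i, hi⟩ := mem_iUnion.1 (hκ₀ hs)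
        exact Or.inr (mem_iUnion.2 ⟨i, hi, fun hsi => hsκ (mem_iUnion.2 ⟨i, hsi⟩)⟩)
      · exact Or.inl ⟨hsγ, hs⟩
    have hf : IsCutoff.sumConst h.isCutoff (fun _ => x) ∈
        approximants K F ‖x‖ x (⋃ i, κ i) γ := by
      rw [IsCutoff.sumConst_const hF h.isCutoff h.disjoint_support]
      exact approximants_mono Subset.rfl (iUnion_subset fun _ => Subset.rfl)
        (IsCutoff.const_mem_approximants _ le_rfl)
    have hν := hF.rieszNu_sub_le hℓ hp (hF.iUnion_mem h.mem) le_rfl hγ hκρ hργ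
      ((hF.smallOn_union hsmall h.smallOn).mono hγκ le_rfl le_rfl) hf
    have hsum := h.sum_sub_le ρ h.subset (fun _ => Subset.rfl) (fun _ => x) fun _ => hr
    linarith [map_sub_le_of_sub_le hν hsum]

theorem rieszNu_union (hF : IsCutoffSystem K F) (hℓ : IsExhaustive ℓ) {α β : Set S}
    (hα : IsRegularFor K ℓ α) (hβ : IsRegularFor K ℓ β) (hd : Disjoint α β) (x : X) :
    rieszNu K ℓ (α ∪ β) x = rieszNu K ℓ α x + rieszNu K ℓ β x := by
  rw [union_eq_iUnion, hF.rieszNu_iUnion hℓ (Bool.forall_bool.2 ⟨hβ, hα⟩)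
    ((pairwise_disjoint_on_bool).2 hd), Fintype.sum_bool]
  rfl

theorem rieszNu_empty (hF : IsCutoffSystem K F) (hℓ : IsExhaustive ℓ) (x : X) :
    rieszNu K ℓ ∅ x = 0 := by
  simpa only [iUnion_of_empty, Finset.univ_eq_empty, Finset.sum_empty] using
    hF.rieszNu_iUnion hℓ (ρ := fun _ : Empty => ∅) nofun nofun x

theorem rieszNu_zero (hF : IsCutoffSystem K F) (hℓ : IsExhaustive ℓ) {α : Set S}
    (hα : IsRegularFor K ℓ α) : rieszNu K ℓ α (0 : X) = 0 :=
  Eq.symm <| eq_of_addGroupSeminorm fun p hp ε hε => by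
    obtain ⟨κ, hκ, γ, hγ, hκα, hαγ, hsmall⟩ := hα p hp (2 * 0) ε hε
    obtain ⟨φ, hφ⟩ := hF.exists_cutoff κ hκ γ hγ (hκα.trans hαγ)
    have h := hF.rieszNu_sub_le hℓ hp hκ (norm_zero.le) hγ hκα hαγ hsmall
      (hφ.const_mem_approximants norm_zero.le)
    rwa [map_zero, map_zero] at h

end IsCutoffSystem

end CutoffApproximations

/-! ### Riemann sums -/

section RiemannSums

open scoped Function

theorem pairwise_disjoint_coe {S : Type*} {R : Finset (Set S)}
    (hd : (R : Set (Set S)).PairwiseDisjoint id) :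
    Pairwise (Disjoint on fun ρ : R => (ρ : Set S)) :=
  (pairwise_subtype_iff_pairwise_set _ _).2 hd

theorem exists_finset_sum_eq {ι S X M : Type*} [Fintype ι] [Zero X] [AddCommMonoid M]
    {h : Set S → X → M} (h0 : ∀ x, h ∅ x = 0) {κ : ι → Set S} (hd : Pairwise (Disjoint on κ))
    (y : ι → X) : ∃ (L : Finset (Set S)) (x : Set S → X), (∀ c ∈ L, ∃ i, κ i = c ∧ x c = y i) ∧
      (L : Set (Set S)).PairwiseDisjoint id ∧ ∑ c ∈ L, h c (x c) = ∑ i, h (κ i) (y i) := by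
  classical
  have hinj : Function.Injective fun i : {i // (κ i).Nonempty} => κ i := fun i j hij => by
    by_contra hne
    exact (hd (Subtype.coe_ne_coe.2 hne)).ne i.2.ne_empty hij
  set x : Set S → X := Function.extend (fun i : {i // (κ i).Nonempty} => κ i) (fun i => y i) 0
  have hx (i : {i // (κ i).Nonempty}) : x (κ i) = y i := hinj.extend_apply _ _ i
  have hL {c} (hc : c ∈ Finset.univ.map ⟨_, hinj⟩) : ∃ i : {i // (κ i).Nonempty}, κ i = c := by
    obtain ⟨i, -, hi⟩ := Finset.mem_map.1 hc
    exact ⟨i, hi⟩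
  refine ⟨Finset.univ.map ⟨_, hinj⟩, x, fun c hc => ?_, fun c hc c' hc' hne => ?_, ?_⟩
  · obtain ⟨i, rfl⟩ := hL hc
    exact ⟨i, rfl, hx i⟩
  · obtain ⟨i, rfl⟩ := hL hc
    obtain ⟨j, rfl⟩ := hL hc'
    exact hd fun hij => hne (congrArg κ hij)
  · rw [Finset.sum_map]
    refine Fintype.sum_of_injective Subtype.val Subtype.val_injective _ _ (fun i hi => ?_)
      fun i => congrArg (h (κ i)) (hx i)
    rw [not_nonempty_iff_eq_empty.1 fun hne => hi ⟨⟨i, hne⟩, rfl⟩, h0]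

variable {S X Z : Type*} [TopologicalSpace S] [NormedAddCommGroup X] [NormedSpace ℝ X]
  [ProperSpace X] [AddCommGroup Z] [Module ℝ Z] [UniformSpace Z] {K : Set (Set S)}
  {F : Submodule ℝ (S → X)} {ℓ : F →ₗ[ℝ] Z} {p : AddGroupSeminorm Z} {r ε : ℝ}

namespace IsCutoffSystem

theorem exists_fine_partition (hF : IsCutoffSystem K F) (hℓ : IsExhaustive ℓ) (f : F) {δ : ℝ}
    (hδ : 0 < δ) {γ : Set S} (hγ : IsOpen γ) :
    ∃ Q : Finset (Set S), (∀ q ∈ Q, IsRegularFor K ℓ q) ∧ (Q : Set (Set S)).PairwiseDisjoint id ∧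
      ⋃₀ (Q : Set (Set S)) = γ ∧
      ∀ q ∈ Q, ∀ s ∈ q, ∀ t ∈ q, ‖(f : S → X) s - (f : S → X) t‖ < δ := by
  classical
  obtain ⟨C, hC⟩ := hF.bounded f f.2
  obtain ⟨T, hT, hcover⟩ := Metric.totallyBounded_iff.1
    (isCompact_closedBall (0 : X) C).totallyBounded (δ / 2) (half_pos hδ)
  let J : Finset (Set S) := hT.toFinset.image fun x => (f : S → X) ⁻¹' Metric.ball x (δ / 2) ∩ γ
  have mem_J {c} : c ∈ J ↔ ∃ x ∈ T, (f : S → X) ⁻¹' Metric.ball x (δ / 2) ∩ γ = c := by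
    simp only [J, Finset.mem_image, Finite.mem_toFinset]
  have hJ : (J : Set (Set S)) ⊆ {α | IsRegularFor K ℓ α} := fun c hc => by
    obtain ⟨x, -, rfl⟩ := mem_J.1 hc
    exact hF.isRegularFor_of_isOpen hℓ
      ((Metric.isOpen_ball.preimage (hF.continuous f f.2)).inter hγ)
  have hJγ : ⋃₀ (J : Set (Set S)) = γ := by
    refine (sUnion_subset fun c hc => ?_).antisymm fun s hs => ?_
    · obtain ⟨x, -, rfl⟩ := mem_J.1 hc
      exact inter_subset_right
    · obtain ⟨x, hx, hsx⟩ := mem_iUnion₂.1 (hcover (mem_closedBall_zero_iff.2 (hC s)))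
      exact ⟨_, mem_J.2 ⟨x, hx, rfl⟩, hsx, hs⟩
  have hring := (hF.isSetAlgebra_isRegularFor hℓ).isSetRing.isSetSemiring
  refine ⟨J.biUnion (hring.disjointOfUnion hJ), fun q hq => ?_, ?_, ?_, fun q hq s hs t ht => ?_⟩
  · obtain ⟨c, hc, hqc⟩ := Finset.mem_biUnion.1 hq
    exact hring.disjointOfUnion_subset hJ hc hqc
  · rw [Finset.coe_biUnion]
    exact hring.pairwiseDisjoint_biUnion_disjointOfUnion hJ
  · rw [Finset.coe_biUnion]
    exact (hring.sUnion_disjointOfUnion hJ).trans hJγ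
  · obtain ⟨c, hc, hqc⟩ := Finset.mem_biUnion.1 hq
    obtain ⟨x, -, rfl⟩ := mem_J.1 hc
    have hball := hring.subset_of_mem_disjointOfUnion hJ hc hqc
    rw [← dist_eq_norm]
    exact (dist_triangle_right _ _ x).trans_lt
      ((add_lt_add (hball hs).1 (hball ht).1).trans_eq (add_halves δ))

variable [IsUniformAddGroup Z] [T2Space Z]

theorem exists_apply_sub_sum_le {ι : Type*} [Fintype ι] (hF : IsCutoffSystem K F)
    (hℓ : IsExhaustive ℓ) (hp : Continuous p) (hε : 0 < ε) {δ : ℝ} (hδ : 0 ≤ δ)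
    (hδℓ : ∀ g ∈ supBall F δ, p (ℓ g) ≤ ε) {ρ : ι → Set S} (hρ : ∀ i, IsRegularFor K ℓ (ρ i))
    (hd : Pairwise (Disjoint on ρ)) {f : F} (hfρ : SupportedBy K (f : S → X) (⋃ i, ρ i))
    {y : ι → X} (hy : ∀ i, ∀ s ∈ ρ i, ‖(f : S → X) s - y i‖ < δ) :
    ∃ κ : ι → Set S, (∀ i, κ i ∈ K) ∧ (∀ i, κ i ⊆ ρ i) ∧
      ∀ α : ι → Set S, (∀ i, κ i ⊆ α i) → (∀ i, α i ⊆ ρ i) →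
        p (ℓ f - ∑ i, rieszNu K ℓ (α i) (y i)) ≤ ε + ε + ε := by
  obtain ⟨C, hC⟩ := hF.bounded f f.2
  obtain ⟨M, hM⟩ := (finite_range fun i => ‖y i‖).bddAbove
  set r := max (max C M) 0
  have hr : 0 ≤ r := le_max_right _ _
  have hf : f ∈ supBall F r := fun s =>
    (hC s).trans ((le_max_left _ _).trans (le_max_left _ _))
  have hyr (i) : ‖y i‖ ≤ r :=
    (hM (mem_range_self i)).trans ((le_max_right _ _).trans (le_max_left _ _))
  obtain ⟨κ, φ, h⟩ := hF.exists_isCutoffApproximation hℓ hp hr hε hρ hd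
    (β := fun i => {s | ‖(f : S → X) s - y i‖ < δ})
    (fun i => isOpen_lt ((hF.continuous f f.2).sub continuous_const).norm continuous_const) hy
  exact ⟨κ, h.mem, h.subset, fun α => h.apply_sub_sum_le hF hf hfρ hδ hδℓ (fun i s hs => hs.le) hyr⟩

end IsCutoffSystem

end RiemannSums

/-! ### The Riesz measure of an exhaustive linear map -/

section Representation

open scoped Function

theorem RelativelyComplete.of_subset_closure {Z : Type*} [UniformSpace Z] {D E : Set Z}
    (hE : RelativelyComplete E) (h : D ⊆ closure E) : RelativelyComplete D := by
  intro l hl hlD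
  have hDE : closure D ⊆ closure E := closure_minimal h isClosed_closure
  obtain ⟨z, -, hz⟩ := hE l hl (hlD.trans (principal_mono.2 hDE))
  have := hl.1
  exact ⟨z, isClosed_closure.mem_of_tendsto hz (le_principal_iff.1 hlD), hz⟩

variable {S X Z : Type*} [TopologicalSpace S] [NormedAddCommGroup X] [NormedSpace ℝ X]
  [ProperSpace X] [AddCommGroup Z] [Module ℝ Z] [UniformSpace Z] [IsUniformAddGroup Z] [T2Space Z]
  {K : Set (Set S)} {F : Submodule ℝ (S → X)} {ℓ : F →ₗ[ℝ] Z} {p : AddGroupSeminorm Z} {r ε : ℝ}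
  {α : Set S}

namespace IsCutoffSystem

theorem apply_sum_le_of_isSmall (hF : IsCutoffSystem K F) (hℓ : IsExhaustive ℓ) (hr : 0 ≤ r)
    (h : IsSmall K {γ : Set S | IsOpen γ} (rieszNu K ℓ) (Metric.closedBall 0 r)
      {q | p (q.2 - q.1) < ε} α) {ι : Type*} [Fintype ι] {κ : ι → Set S} (hκ : ∀ i, κ i ∈ K)
    (hκα : ∀ i, κ i ⊆ α) (hd : Pairwise (Disjoint on κ)) {y : ι → X} (hy : ∀ i, ‖y i‖ ≤ r) :
    p (∑ i, rieszNu K ℓ (κ i) (y i)) < ε := by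
  obtain ⟨γ, -, hαγ, hsmall⟩ := h
  obtain ⟨L, x, hL, hLd, hsum⟩ := exists_finset_sum_eq (hF.rieszNu_empty hℓ) hd y
  have hLK : (L : Set (Set S)) ⊆ K := fun c hc => by
    obtain ⟨i, rfl, -⟩ := hL c hc
    exact hκ i
  have hLγ : ∀ c ∈ L, c ⊆ γ := fun c hc => by
    obtain ⟨i, rfl, -⟩ := hL c hc
    exact (hκα i).trans hαγ
  have hx : ∀ c ∈ L, x c ∈ Metric.closedBall 0 r := fun c hc => by
    obtain ⟨i, -, hi⟩ := hL c hc
    exact mem_closedBall_zero_iff.2 (hi ▸ hy i)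
  have hzero : ∑ c ∈ L, rieszNu K ℓ c (0 : X) = 0 := Finset.sum_eq_zero fun c hc =>
    hF.rieszNu_zero hℓ (hF.isRegularFor_of_mem hℓ (hLK hc))
  have hlt := hsmall L hLK hLd hLγ (fun _ => 0) x (fun _ _ => Metric.mem_closedBall_self hr) hx
  simp only [mem_ofPred_eq, hzero, zero_add, sub_zero, hsum] at hlt
  exact hlt

theorem smallOn_of_isSmall (hF : IsCutoffSystem K F) (hℓ : IsExhaustive ℓ) (hp : Continuous p)
    (hr : 0 ≤ r) (hε : 0 < ε)
    (h : IsSmall K {γ : Set S | IsOpen γ} (rieszNu K ℓ) (Metric.closedBall 0 r)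
      {q | p (q.2 - q.1) < ε / 4} α) : SmallOn K ℓ p r ε α := by
  obtain ⟨γ, hγ, hαγ, hsmall⟩ := h
  refine ⟨γ, hγ, hαγ, fun f hf hfγ => ?_⟩
  have hε4 : 0 < ε / 4 := by positivity
  obtain ⟨δ, hδ, hδℓ⟩ := hℓ.exists_le hp hε4
  obtain ⟨Q, hQ, hd, hQγ, hosc⟩ := hF.exists_fine_partition hℓ f hδ hγ
  have hy (q : Q) : ∃ y : X, ‖y‖ ≤ r ∧ ∀ s ∈ (q : Set S), ‖(f : S → X) s - y‖ < δ := by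
    rcases (q : Set S).eq_empty_or_nonempty with hq | ⟨t, ht⟩
    · exact ⟨0, norm_zero.trans_le hr, fun s hs => absurd hs (hq ▸ notMem_empty s)⟩
    · exact ⟨(f : S → X) t, hf t, fun s hs => hosc q q.2 s hs t ht⟩
  choose y hyr hy using hy
  have hfQ : SupportedBy K (f : S → X) (⋃ q : Q, (q : Set S)) :=
    hfγ.mono (hQγ.symm.trans sUnion_eq_iUnion).subset
  obtain ⟨κ, hκ, hκQ, hsum⟩ := hF.exists_apply_sub_sum_le hℓ hp hε4 hδ.le hδℓ
    (fun q : Q => hQ q q.2) (pairwise_disjoint_coe hd) hfQ hy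
  have hκd : Pairwise (Disjoint on κ) :=
    (pairwise_disjoint_coe hd).mono fun i j hij => hij.mono (hκQ i) (hκQ j)
  have hκγ (q : Q) : κ q ⊆ γ := (hκQ q).trans (hQγ ▸ subset_sUnion_of_mem (Finset.mem_coe.2 q.2))
  have hlt := hF.apply_sum_le_of_isSmall hℓ hr ⟨γ, hγ, Subset.rfl, hsmall⟩ hκ hκγ hκd hyr
  calc p (ℓ f) = p (ℓ f - ∑ q, rieszNu K ℓ (κ q) (y q) + ∑ q, rieszNu K ℓ (κ q) (y q)) := by
        rw [sub_add_cancel]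
    _ ≤ p (ℓ f - ∑ q, rieszNu K ℓ (κ q) (y q)) + p (∑ q, rieszNu K ℓ (κ q) (y q)) :=
        map_add_le_add p _ _
    _ ≤ ε := by linarith [hsum κ (fun _ => Subset.rfl) hκQ]

theorem isSmall_of_smallOn (hF : IsCutoffSystem K F) (hℓ : IsExhaustive ℓ) (hp : Continuous p)
    (hr : 0 ≤ r) {B : Set X} (hB : ∀ x ∈ B, ‖x‖ ≤ r) {V : Set (Z × Z)}
    (hV : ∀ a b, p (b - a) < 1 → (a, b) ∈ V) (h : SmallOn K ℓ p r (1 / 2) α) :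
    IsSmall K {γ : Set S | IsOpen γ} (rieszNu K ℓ) B V α := by
  obtain ⟨γ, hγ, hαγ, hsmall⟩ := h
  refine ⟨γ, hγ, hαγ, fun L hL hd hLγ x y hx hy => hV _ _ ?_⟩
  obtain ⟨κ, φ, h⟩ := hF.exists_isCutoffApproximation (ρ := fun κ : L => (κ : Set S)) hℓ hp
    (by positivity : 0 ≤ 2 * r) (by norm_num : (0 : ℝ) < 1 / 8)
    (fun κ => hF.isRegularFor_of_mem hℓ (hL κ.2)) (pairwise_disjoint_coe hd) (fun _ => hγ)
    fun κ => hLγ κ κ.2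
  have hxr (κ : L) : ‖x κ‖ ≤ r := hB _ (hx κ κ.2)
  have hyr (κ : L) : ‖y κ‖ ≤ r := hB _ (hy κ κ.2)
  have hℓy : p (ℓ (IsCutoff.sumConst h.isCutoff fun κ => y κ)) ≤ 1 / 2 :=
    hsmall _ (IsCutoff.sumConst_mem_supBall h.isCutoff h.disjoint_support hr hyr)
      ((IsCutoff.sumConst_supportedBy hF h.isCutoff _).mono (iUnion_subset fun _ => Subset.rfl))
  have hle := h.sum_sub_sum_le (x := fun κ => x κ) (y := fun κ => x κ + y κ) (ε' := 1 / 2)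
    (fun κ => by linarith [hxr κ])
    (fun κ => (norm_add_le _ _).trans (by linarith [hxr κ, hyr κ]))
    (by simpa only [Pi.sub_def, add_sub_cancel_left] using hℓy)
  rw [Finset.sum_coe_sort L fun κ => rieszNu K ℓ κ (x κ),
    Finset.sum_coe_sort L fun κ => rieszNu K ℓ κ (x κ + y κ)] at hle
  exact hle.trans_lt (by norm_num)

theorem regularSets_rieszNu (hF : IsCutoffSystem K F) (hℓ : IsExhaustive ℓ) :
    regularSets K {γ : Set S | IsOpen γ} (closedBalancedTotallyBounded X) (rieszNu K ℓ) =
      {α | IsRegularFor K ℓ α} := by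
  refine Subset.antisymm (fun α hα p hp r ε hε => ?_) fun α hα B hB V hV => ?_
  · have hr : 0 ≤ max r 0 := le_max_right _ _
    obtain ⟨κ, hκ, γ, hγ, hκα, hαγ, hsmall⟩ := hα _
      (closedBall_mem_closedBalancedTotallyBounded hr) _
      (addGroupSeminorm_mem_uniformity hp (by positivity : 0 < ε / 4))
    exact ⟨κ, hκ, γ, hγ, hκα, hαγ,
      (hF.smallOn_of_isSmall hℓ hp hr hε hsmall).mono Subset.rfl (le_max_left _ _) le_rfl⟩
  · obtain ⟨r, hr, hBr⟩ := exists_norm_le_of_mem_closedBalancedTotallyBounded hB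
    obtain ⟨p, hp, hpV⟩ := exists_addGroupSeminorm_of_mem_uniformity hV
    obtain ⟨κ, hκ, γ, hγ, hκα, hαγ, hsmall⟩ := hα p hp r (1 / 2) one_half_pos
    exact ⟨κ, hκ, γ, hγ, hκα, hαγ, hF.isSmall_of_smallOn hℓ hp hr hBr hpV hsmall⟩

theorem rieszNu_union_add_inter (hF : IsCutoffSystem K F) (hℓ : IsExhaustive ℓ) {β : Set S}
    (hα : IsRegularFor K ℓ α) (hβ : IsRegularFor K ℓ β) (x : X) :
    rieszNu K ℓ (α ∪ β) x + rieszNu K ℓ (α ∩ β) x = rieszNu K ℓ α x + rieszNu K ℓ β x := by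
  have halg := hF.isSetAlgebra_isRegularFor hℓ
  have hdiff : IsRegularFor K ℓ (β \ α) := halg.sdiff_mem hβ hα
  have hunion := hF.rieszNu_union hℓ hα hdiff disjoint_sdiff_right x
  have hβx := hF.rieszNu_union hℓ hdiff (halg.inter_mem hβ hα) disjoint_sdiff_inter x
  rw [union_sdiff_self] at hunion
  rw [sdiff_union_inter] at hβx
  rw [hunion, hβx, inter_comm α β, add_assoc]

theorem sum_rieszNu_mem_uniformity (hF : IsCutoffSystem K F) (hℓ : IsExhaustive ℓ) (hr : 0 ≤ r)
    {V : Set (Z × Z)} (hV : V ∈ uniformity Z) : ∃ δ > 0, ∀ R : Finset (Set S),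
      (∀ ρ ∈ R, IsRegularFor K ℓ ρ) → (R : Set (Set S)).PairwiseDisjoint id → ∀ x y : Set S → X,
        (∀ ρ ∈ R, ‖x ρ‖ ≤ r) → (∀ ρ ∈ R, ‖y ρ‖ ≤ r) → (∀ ρ ∈ R, dist (x ρ) (y ρ) < δ) →
          (∑ ρ ∈ R, rieszNu K ℓ ρ (x ρ), ∑ ρ ∈ R, rieszNu K ℓ ρ (y ρ)) ∈ V := by
  obtain ⟨p, hp, hpV⟩ := exists_addGroupSeminorm_of_mem_uniformity hV
  obtain ⟨δ, hδ, hδℓ⟩ := hℓ.exists_le hp (by norm_num : (0 : ℝ) < 1 / 4)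
  refine ⟨δ, hδ, fun R hR hd x y hx hy hxy => hpV _ _ ?_⟩
  obtain ⟨κ, φ, h⟩ := hF.exists_isCutoffApproximation (ρ := fun ρ : R => (ρ : Set S)) hℓ hp hr
    (by norm_num : (0 : ℝ) < 1 / 4) (fun ρ => hR ρ ρ.2) (pairwise_disjoint_coe hd)
    (fun _ => isOpen_univ) fun _ => subset_univ _
  have hle := h.sum_sub_sum_le (x := fun ρ => x ρ) (y := fun ρ => y ρ) (fun ρ => hx ρ ρ.2)
    (fun ρ => hy ρ ρ.2) <| hδℓ _ <|
      IsCutoff.sumConst_mem_supBall h.isCutoff h.disjoint_support hδ.le fun ρ =>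
        (dist_eq_norm' (x ρ) (y ρ)).symm.trans_le (hxy ρ ρ.2).le
  rw [Finset.sum_coe_sort R fun ρ => rieszNu K ℓ ρ (x ρ),
    Finset.sum_coe_sort R fun ρ => rieszNu K ℓ ρ (y ρ)] at hle
  linarith

theorem sum_rieszNu_mem_closure (hF : IsCutoffSystem K F) (hℓ : IsExhaustive ℓ) (hr : 0 ≤ r)
    {R : Finset (Set S)} (hR : ∀ ρ ∈ R, IsRegularFor K ℓ ρ)
    (hd : (R : Set (Set S)).PairwiseDisjoint id) {x : Set S → X} (hx : ∀ ρ ∈ R, ‖x ρ‖ ≤ r) :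
    ∑ ρ ∈ R, rieszNu K ℓ ρ (x ρ) ∈ closure (ℓ '' supBall F r) := by
  refine mem_closure_of_addGroupSeminorm fun p hp ε hε => ?_
  obtain ⟨κ, φ, h⟩ := hF.exists_isCutoffApproximation (ρ := fun ρ : R => (ρ : Set S)) hℓ hp hr hε
    (fun ρ => hR ρ ρ.2) (pairwise_disjoint_coe hd) (fun _ => isOpen_univ) fun _ => subset_univ _
  have hxr (ρ : R) : ‖x ρ‖ ≤ r := hx ρ ρ.2
  refine ⟨_, mem_image_of_mem ℓ
    (IsCutoff.sumConst_mem_supBall h.isCutoff h.disjoint_support hr hxr), ?_⟩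
  rw [map_sub_rev, ← Finset.sum_coe_sort R fun ρ => rieszNu K ℓ ρ (x ρ)]
  exact h.sum_sub_le _ h.subset (fun _ => Subset.rfl) _ hxr

theorem isRieszMeasure_rieszNu (hF : IsCutoffSystem K F) (hℓ : IsExhaustive ℓ) :
    IsRieszMeasure K {γ : Set S | IsOpen γ} (closedBalancedTotallyBounded X) (rieszNu K ℓ) where
  subset_regularSets := by
    rw [hF.regularSets_rieszNu hℓ]
    exact fun γ => hF.isRegularFor_of_isOpen hℓ
  isSetAlgebra := by
    rw [hF.regularSets_rieszNu hℓ]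
    exact hF.isSetAlgebra_isRegularFor hℓ
  map_empty := funext (hF.rieszNu_empty hℓ)
  additive := by
    rw [hF.regularSets_rieszNu hℓ]
    exact fun α hα β hβ => funext (hF.rieszNu_union_add_inter hℓ hα hβ)
  inner_limit γ hγ x := by
    rw [hF.rieszNu_eq_rieszXi hℓ hγ]
    exact (hF.tendsto_rieszXi hℓ hγ x).congr fun κ => (hF.rieszNu_eq_rieszTau hℓ κ.2.1 x).symm
  outer_limit α x := (hF.tendsto_rieszNu hℓ α x).congr fun γ =>
    (hF.rieszNu_eq_rieszXi hℓ γ.2.1 x).symm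
  partition_continuous := by
    rw [hF.regularSets_rieszNu hℓ]
    intro W hW B hB
    obtain ⟨r, hr, hBr⟩ := exists_norm_le_of_mem_closedBalancedTotallyBounded hB
    obtain ⟨δ, hδ, h⟩ := hF.sum_rieszNu_mem_uniformity hℓ hr hW
    exact ⟨_, Metric.dist_mem_uniformity hδ, fun R hR hd x y hx hy =>
      h R hR hd x y (fun ρ hρ => hBr _ (hx ρ hρ)) fun ρ hρ => hBr _ (hy ρ hρ)⟩
  s_bounded := by
    rw [hF.regularSets_rieszNu hℓ]
    intro B hB α hα hd V hV
    obtain ⟨r, hr, hBr⟩ := exists_norm_le_of_mem_closedBalancedTotallyBounded hB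
    obtain ⟨p, hp, hpV⟩ := exists_addGroupSeminorm_of_mem_uniformity hV
    obtain ⟨m, hm⟩ := eventually_atTop.1 (hF.eventually_smallOn hℓ hp r one_half_pos hα hd)
    exact ⟨m, fun n hn => hF.isSmall_of_smallOn hℓ hp hr hBr hpV (hm n hn.le)⟩
  relativelyComplete_sums := by
    rw [hF.regularSets_rieszNu hℓ]
    intro B hB
    obtain ⟨r, hr, hBr⟩ := exists_norm_le_of_mem_closedBalancedTotallyBounded hB
    refine (hℓ.relativelyComplete r).of_subset_closure ?_
    rintro z ⟨R, x, hR, hd, hx, rfl⟩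
    exact hF.sum_rieszNu_mem_closure hℓ hr hR hd fun ρ hρ => hBr _ (hx ρ hρ)

theorem hasRieszIntegral (hF : IsCutoffSystem K F) (hℓ : IsExhaustive ℓ) (f : F) :
    HasRieszIntegral K {γ : Set S | IsOpen γ} (closedBalancedTotallyBounded X) (rieszNu K ℓ) univ
      (f : S → X) (ℓ f) := by
  intro V hV
  obtain ⟨W, hW, hWV⟩ := UniformSpace.mem_nhds_iff.1 hV
  obtain ⟨p, hp, hpW⟩ := exists_addGroupSeminorm_of_mem_uniformity hW
  have hε : (0 : ℝ) < 1 / 4 := by norm_num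
  obtain ⟨δ, hδ, hδℓ⟩ := hℓ.exists_le hp hε
  obtain ⟨Q, hQ, hQd, hQU, hosc⟩ := hF.exists_fine_partition hℓ f hδ isOpen_univ
  unfold IsRegularPartition
  rw [hF.regularSets_rieszNu hℓ]
  refine ⟨Q, ⟨hQ, hQd, hQU⟩, fun R ⟨hR, hRd, hRU⟩ hRQ s hs => hWV (hpW _ _ ?_)⟩
  have hfR : SupportedBy K (f : S → X) (⋃ ρ : R, (ρ : Set S)) :=
    (hF.supportedBy_univ f f.2).mono (hRU.symm.trans sUnion_eq_iUnion).subset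
  have hfs (ρ : R) : ∀ t ∈ (ρ : Set S), ‖(f : S → X) t - (f : S → X) (s ρ)‖ < δ := fun t ht => by
    obtain ⟨q, hq, hρq⟩ := hRQ ρ ρ.2
    exact hosc q hq t (hρq ht) _ (hρq (hs ρ))
  obtain ⟨κ, -, hκ, hle⟩ := hF.exists_apply_sub_sum_le hℓ hp hε hδ.le hδℓ (fun ρ : R => hR ρ.2)
    (pairwise_disjoint_coe hRd) hfR hfs
  rw [map_sub_rev]
  exact (hle _ hκ fun _ => Subset.rfl).trans_lt (by norm_num)

theorem representedByRieszMeasure (hF : IsCutoffSystem K F) (hℓ : IsExhaustive ℓ) :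
    RepresentedByRieszMeasure K {γ : Set S | IsOpen γ} (closedBalancedTotallyBounded X) F ℓ where
  approxFilter_neBot _ hκ _ _ hB hx := hF.neBot_approxFilter hκ (sInter_subset_of_mem ⟨hB, hx⟩)
  tendsto_tau _ hκ _ _ hB hx := hF.tendsto_rieszTau hℓ hκ hB hx
  tendsto_xi _ hγ := hF.tendsto_rieszXi hℓ hγ
  tendsto_nu := hF.tendsto_rieszNu hℓ
  isRieszMeasure := hF.isRieszMeasure_rieszNu hℓ
  hasIntegral := hF.hasRieszIntegral hℓ

end IsCutoffSystem

end Representation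

/-! ### Exhaustivity from perfectness -/

section Perfectness

open scoped Function

variable {S X Z : Type*} [NormedAddCommGroup X] [NormedSpace ℝ X] {F : Submodule ℝ (S → X)}

theorem sum_mem_supBall {ι : Type*} {f : ι → F} {r : ℝ} (hr : 0 ≤ r) (hf : ∀ i, f i ∈ supBall F r)
    (hd : Pairwise (Disjoint on fun i => Function.support (f i : S → X))) (J : Finset ι) :
    ∑ i ∈ J, f i ∈ supBall F r := fun s => by
  rw [Submodule.coe_sum, Finset.sum_apply, ← Finset.sum_coe_sort J fun i => (f i : S → X) s]
  rcases sum_apply_eq_zero_or_exists (g := fun i : J => (f i : S → X))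
    (hd.comp_of_injective Subtype.val_injective) s with h | ⟨i, -, h⟩
  · rwa [h, norm_zero]
  · rw [h]
    exact hf i s

variable [AddCommGroup Z] [Module ℝ Z] [UniformSpace Z] {ℓ : F →ₗ[ℝ] Z}

namespace ContinuousForUniformConvergence

theorem exists_forall_mem
    (hℓ : ContinuousForUniformConvergence F ℓ) {V : Set Z} (hV : V ∈ 𝓝 0) :
    ∃ δ > 0, ∀ f ∈ supBall F δ, ℓ f ∈ V := by
  let _ : TopologicalSpace F :=
    TopologicalSpace.induced (fun f : F => UniformFun.ofFun (f : S → X)) inferInstance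
  have hcont : Continuous ℓ := hℓ
  have hpre : ℓ ⁻¹' V ∈ 𝓝 (0 : F) := hcont.continuousAt.preimage_mem_nhds (by rwa [map_zero])
  rw [nhds_induced] at hpre
  obtain ⟨U, hU, hUV⟩ := hpre
  obtain ⟨δ, hδ, hδU⟩ := (UniformFun.hasBasis_nhds_of_basis S X _
    Metric.uniformity_basis_dist_le).mem_iff.1 hU
  exact ⟨δ, hδ, fun f hf => hUV (hδU fun s => (dist_zero_left _).trans_le (hf s))⟩

theorem isVonNBounded_image_supBall
    (hℓ : ContinuousForUniformConvergence F ℓ) (r : ℝ) :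
    Bornology.IsVonNBounded ℝ (ℓ '' supBall F r) := by
  intro V hV
  obtain ⟨δ, hδ, h⟩ := hℓ.exists_forall_mem hV
  refine Absorbs.of_norm ⟨max 1 (r / δ), fun c hc => image_subset_iff.2 fun f hf => ?_⟩
  have hc0 : 0 < ‖c‖ := one_pos.trans_le ((le_max_left _ _).trans hc)
  have hrc : r ≤ ‖c‖ * δ := (div_le_iff₀ hδ).1 ((le_max_right _ _).trans hc)
  refine ⟨ℓ (c⁻¹ • f), h _ fun s => ?_, ?_⟩
  · change ‖c⁻¹ • (f : S → X) s‖ ≤ δ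
    rw [norm_smul, norm_inv, inv_mul_le_iff₀ hc0]
    exact (hf s).trans hrc
  · change c • ℓ (c⁻¹ • f) = ℓ f
    rw [map_smul, smul_inv_smul₀ (norm_pos_iff.1 hc0)]

end ContinuousForUniformConvergence

theorem IsExhaustive.of_continuous [IsUniformAddGroup Z]
    (hZ : ∀ E : Set Z, Bornology.IsVonNBounded ℝ E → RelativelyComplete E ∧ PerfectForSums E)
    (hℓ : ContinuousForUniformConvergence F ℓ) : IsExhaustive ℓ where
  eventually_mem _ hV := hℓ.exists_forall_mem hV
  tendsto_zero r f hf hd := by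
    have hsum : Summable fun k => ℓ (f k) :=
      (hZ _ (hℓ.isVonNBounded_image_supBall (max r 0))).2 ℕ _ fun J =>
        ⟨∑ j ∈ J, f j, sum_mem_supBall (le_max_right _ _)
          (fun k s => (hf k s).trans (le_max_left _ _)) hd J, map_sum _ _ _⟩
    exact hsum.tendsto_atTop_zero
  relativelyComplete r := (hZ _ (hℓ.isVonNBounded_image_supBall r)).1

end Perfectness

theorem theorem1p3_general {S X Z : Type*} [TopologicalSpace S] [NormedAddCommGroup X]
    [NormedSpace ℝ X] [ProperSpace X] [AddCommGroup Z] [Module ℝ Z] [UniformSpace Z]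
    [IsUniformAddGroup Z] [T2Space Z] {K : Set (Set S)} {F : Submodule ℝ (S → X)}
    (hF : IsCutoffSystem K F)
    (hZ : ∀ E : Set Z, Bornology.IsVonNBounded ℝ E → RelativelyComplete E ∧ PerfectForSums E)
    {ℓ : F →ₗ[ℝ] Z} (hℓ : ContinuousForUniformConvergence F ℓ) :
    RepresentedByRieszMeasure K {γ : Set S | IsOpen γ} (closedBalancedTotallyBounded X) F ℓ :=
  hF.representedByRieszMeasure (.of_continuous hZ hℓ)

/-! ### Bounded continuous functions and test functions -/

section FunctionSpaces

open scoped Manifold ContDiff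

section Continuous

variable {S X : Type*} [TopologicalSpace S] [NormedAddCommGroup X] [NormedSpace ℝ X]

theorem exists_norm_le_of_mem_Cp {f : S → X} (hf : f ∈ Cp S X) : ∃ C : ℝ, ∀ s, ‖f s‖ ≤ C := by
  obtain ⟨C, hC⟩ := hf.2.isBounded.exists_norm_le
  exact ⟨C, fun s => hC _ (mem_range_self s)⟩

theorem smul_mem_Cp [ProperSpace X] {φ : S → ℝ} (hφ : Continuous φ)
    (hφI : ∀ s, φ s ∈ Icc (0 : ℝ) 1) {f : S → X} (hf : Continuous f) {C : ℝ}
    (hC : ∀ s, ‖f s‖ ≤ C) : (fun s => φ s • f s) ∈ Cp S X := by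
  refine ⟨hφ.smul hf, (isCompact_closedBall (0 : X) C).totallyBounded.subset ?_⟩
  rintro _ ⟨s, rfl⟩
  rw [mem_closedBall_zero_iff, norm_smul, Real.norm_of_nonneg (hφI s).1]
  exact (mul_le_of_le_one_left (norm_nonneg _) (hφI s).2).trans (hC s)

theorem exists_continuous_cutoff [NormalSpace S] {κ β : Set S} (hκ : IsClosed κ) (hβ : IsOpen β)
    (hκβ : κ ⊆ β) : ∃ φ : S → ℝ, Continuous φ ∧ (∀ s, φ s ∈ Icc (0 : ℝ) 1) ∧
      EqualsOver {γ : Set S | IsOpen γ} φ 1 κ ∧ SupportedBy {σ : Set S | IsClosed σ} φ β := by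
  obtain ⟨u, hu, hκu, huβ⟩ := normal_exists_closure_subset hκ hβ hκβ
  obtain ⟨v, hv, huv, hvβ⟩ := normal_exists_closure_subset isClosed_closure hβ huβ
  obtain ⟨φ, hφ0, hφ1, hφ⟩ := exists_continuous_zero_one_of_isClosed hv.isClosed_compl
    (isClosed_closure (s := u)) (disjoint_compl_left.mono_right huv)
  exact ⟨φ, φ.continuous, hφ, ⟨u, hu, hκu, fun s hs => hφ1 (subset_closure hs)⟩,
    ⟨closure v, isClosed_closure, hvβ, fun s hs => hφ0 fun h => hs (subset_closure h)⟩⟩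

theorem isCutoffSystem_Cp [NormalSpace S] [ProperSpace X] :
    IsCutoffSystem {κ : Set S | IsClosed κ} (Cp S X) where
  isClosed _ hκ := hκ
  empty_mem := isClosed_empty
  union_mem _ hκ _ hκ' := IsClosed.union hκ hκ'
  inter_mem _ hκ _ hc := IsClosed.inter hκ hc
  continuous _ hf := hf.1
  bounded _ hf := exists_norm_le_of_mem_Cp hf
  supportedBy_univ _ _ := ⟨univ, isClosed_univ, Subset.rfl, fun s hs => absurd (mem_univ s) hs⟩
  exists_cutoff κ hκ β hβ hκβ := by
    obtain ⟨φ, hφ, hφI, hφκ, hφβ⟩ := exists_continuous_cutoff hκ hβ hκβ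
    refine ⟨φ, hφI, hφκ, hφβ, fun x => smul_mem_Cp hφ hφI continuous_const fun _ => le_rfl,
      fun f hf => ?_⟩
    obtain ⟨C, hC⟩ := exists_norm_le_of_mem_Cp hf
    exact smul_mem_Cp hφ hφI hf.1 hC

end Continuous

section Smooth

theorem supportedBy_isCompact_of_tsupport_subset {E Y : Type*} [TopologicalSpace E]
    {Ω : TopologicalSpace.Opens E} [AddCommGroup Y] {g : E → Y} (hg : HasCompactSupport g)
    {β : Set Ω} (hgβ : tsupport g ⊆ Subtype.val '' β) :
    SupportedBy {κ : Set Ω | IsCompact κ} (fun s : Ω => g s) β := by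
  have hgΩ : tsupport g ⊆ range ((↑) : Ω → E) := hgβ.trans (image_subset_range _ _)
  refine ⟨Subtype.val ⁻¹' tsupport g,
    (Topology.IsInducing.subtypeVal.isCompact_preimage_iff hgΩ).2 hg, ?_,
    fun s hs => image_eq_zero_of_notMem_tsupport hs⟩
  exact (preimage_mono hgβ).trans (preimage_image_eq β Subtype.val_injective).subset

variable {E X : Type*} [NormedAddCommGroup E] [NormedSpace ℝ E] [NormedAddCommGroup X]
  [NormedSpace ℝ X] {Ω : TopologicalSpace.Opens E}

theorem smul_mem_CcSmooth {φ : E → ℝ} (hφ : ContDiff ℝ ∞ φ) (hφc : HasCompactSupport φ)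
    (hφΩ : tsupport φ ⊆ Ω) {g : E → X} (hg : ContDiff ℝ ∞ g) :
    (fun s : Ω => φ s • g s) ∈ CcSmooth Ω X :=
  ⟨⟨fun s => φ s • g s, hφ.smul hg, hφc.smul_right,
    (tsupport_smul_subset_left φ g).trans hφΩ⟩, fun _ => rfl⟩

variable [FiniteDimensional ℝ E]

theorem exists_smooth_cutoff {κ β : Set E} (hκ : IsCompact κ) (hβ : IsOpen β) (hκβ : κ ⊆ β) :
    ∃ φ : E → ℝ, ContDiff ℝ ∞ φ ∧ (∀ s, φ s ∈ Icc (0 : ℝ) 1) ∧ HasCompactSupport φ ∧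
      tsupport φ ⊆ β ∧ EqualsOver {γ : Set E | IsOpen γ} φ 1 κ := by
  have : ProperSpace E := FiniteDimensional.proper ℝ E
  obtain ⟨L, hL, hκL, hLβ⟩ := exists_compact_between hκ hβ hκβ
  obtain ⟨M, hM, hκM, hML⟩ := exists_compact_between hκ isOpen_interior hκL
  obtain ⟨φ, hφ0, hφ1, hφ⟩ := exists_contMDiffMap_zero_one_of_isClosed (n := ⊤) 𝓘(ℝ, E)
    (isOpen_interior (s := L)).isClosed_compl hM.isClosed (disjoint_compl_left.mono_right hML)
  have hφL : tsupport φ ⊆ L := closure_minimal (fun s hs => by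
    by_contra h
    exact hs (hφ0 fun hsL => h (interior_subset hsL))) hL.isClosed
  exact ⟨φ, φ.contMDiff.contDiff, hφ, hL.of_isClosed_subset (isClosed_tsupport _) hφL,
    hφL.trans hLβ, interior M, isOpen_interior, hκM, fun s hs => hφ1 (interior_subset hs)⟩

theorem isCutoffSystem_CcSmooth : IsCutoffSystem {κ : Set Ω | IsCompact κ} (CcSmooth Ω X) where
  isClosed _ hκ := IsCompact.isClosed hκ
  empty_mem := isCompact_empty
  union_mem _ hκ _ hκ' := IsCompact.union hκ hκ'
  inter_mem _ hκ _ hc := IsCompact.inter_right hκ hc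
  continuous := by
    rintro f ⟨g, hg⟩
    rw [funext hg]
    exact g.continuous.comp continuous_subtype_val
  bounded := by
    rintro f ⟨g, hg⟩
    obtain ⟨C, hC⟩ := g.hasCompactSupport.exists_bound_of_continuous g.continuous
    exact ⟨C, fun s => (congrArg norm (hg s)).trans_le (hC s)⟩
  supportedBy_univ := by
    rintro f ⟨g, hg⟩
    rw [funext hg]
    refine supportedBy_isCompact_of_tsupport_subset g.hasCompactSupport ?_
    rw [image_univ, Subtype.range_coe]
    exact g.tsupport_subset
  exists_cutoff κ hκ β hβ hκβ := by
    obtain ⟨φ, hφ, hφI, hφc, hφβ, w, hw, hκw, hw1⟩ := exists_smooth_cutoff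
      (hκ.image continuous_subtype_val) (Ω.isOpen.isOpenMap_subtype_val β hβ) (image_mono hκβ)
    have hφΩ : tsupport φ ⊆ Ω := hφβ.trans (Subtype.coe_image_subset (Ω : Set E) β)
    refine ⟨fun s => φ s, fun s => hφI s, ⟨Subtype.val ⁻¹' w, hw.preimage continuous_subtype_val,
      image_subset_iff.1 hκw, fun s => hw1 s⟩, supportedBy_isCompact_of_tsupport_subset hφc hφβ,
      fun x => smul_mem_CcSmooth hφ hφc hφΩ contDiff_const, ?_⟩
    rintro f ⟨g, hg⟩
    rw [funext hg]
    exact smul_mem_CcSmooth hφ hφc hφΩ g.contDiff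

end Smooth

end FunctionSpaces

theorem theorem1p3 {n m : ℕ} (Ω : TopologicalSpace.Opens (EuclideanSpace ℝ (Fin n)))
    {Z : Type*} [AddCommGroup Z] [Module ℝ Z] [UniformSpace Z] [IsUniformAddGroup Z]
    [ContinuousSMul ℝ Z] [T2Space Z]
    (hZ : ∀ E : Set Z, Bornology.IsVonNBounded ℝ E → RelativelyComplete E ∧ PerfectForSums E) :
    (∀ ℓ : Cp Ω (EuclideanSpace ℝ (Fin m)) →ₗ[ℝ] Z,
      ContinuousForUniformConvergence (Cp Ω (EuclideanSpace ℝ (Fin m))) ℓ →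
      RepresentedByRieszMeasure {κ : Set Ω | IsClosed κ} {γ : Set Ω | IsOpen γ}
        (closedBalancedTotallyBounded (EuclideanSpace ℝ (Fin m)))
        (Cp Ω (EuclideanSpace ℝ (Fin m))) ℓ) ∧
    (∀ ℓ : CcSmooth Ω (EuclideanSpace ℝ (Fin m)) →ₗ[ℝ] Z,
      ContinuousForUniformConvergence (CcSmooth Ω (EuclideanSpace ℝ (Fin m))) ℓ →
      RepresentedByRieszMeasure {κ : Set Ω | IsCompact κ} {γ : Set Ω | IsOpen γ}
        (closedBalancedTotallyBounded (EuclideanSpace ℝ (Fin m)))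
        (CcSmooth Ω (EuclideanSpace ℝ (Fin m))) ℓ) :=
  ⟨fun _ => theorem1p3_general isCutoffSystem_Cp hZ,
    fun _ => theorem1p3_general isCutoffSystem_CcSmooth hZ⟩
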